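/- Let $k$ be a commutative ring and $\mathcal C$ a $k$-linear abelian category. Let $T\in D^b(\mathcal C)$ (for instance $T=\bigoplus_i T_i$) and $A=\mathrm{End}_{D^b(\mathcal C)}(T)$. All $\mathrm{RHom}_{\mathcal C}$'s are computed in the Grothendieck category $\mathrm{Ind}(\mathcal C)\supset\mathcal C$ of ind-objects, by K-injective resolutions. Let $X$ be a complex of ind-objects representing $T$, with a $k$-linear action of $A$ by chain endomorphisms inducing the tautological action of $A$ on $T$ (if $T\in\mathcal C$, take $X=T$; if $k$ is a field and $\mathrm{Ext}^n(T,T)=0$ for $n\neq0$, such an $X$ always exists and is essentially unique). The functor $$\Psi=\mathrm{RHom}_{\mathcal C}(T,-):D^b(\mathcal C)\to D(\mathrm{Mod}\text{-}A)$$ is the right derived functor of the functor $Y\mapsto \mathrm{Hom}^\bullet(X,Y)$ with values in complexes of right $A$-modules. Let $\mathcal M$ be a class of right $A$-modules containing $A$, and let $D^b(A)\subset D(\mathrm{Mod}\text{-}A)$ be the full subcategory of bounded complexes with cohomology in $\mathcal M$. (For $\mathcal M$ the class of all modules this is $D^b(\mathrm{Mod}\text{-}A)$; for $A$ right noetherian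 and $\mathcal M$ the class of finitely generated modules it is the bounded derived category of finitely generated modules.) Suppose that $T$ is a tilting object, i.e. that $\Psi$ is an equivalence of $D^b(\mathcal C)$ onto $D^b(A)$. Then $\Psi$ is a dg equivalence: 1. For every family $(E_i)_{i\in I}$ of objects of $D^b(\mathcal C)$, the $k$-linear dg categories with set of objects $I$ and with morphism complexes $\mathrm{RHom}_{\mathcal C}(E_i,E_j)$, respectively $\mathrm{RHom}_A(\Psi E_i,\Psi E_j)$, computed with arbitrary K-injective resolutions, are connected by dg functors $\mathrm{RHom}_{\mathcal C}\leftarrow\mathcal S\to\mathrm{RHom}_A$ which are the identity on objects and quasi-isomorphisms on morphism complexes, and which induce on $H^0$ the map $\Psi:\mathrm{Hom}(E_i,E_j)\to\mathrm{Hom}(\Psi E_i,\Psi E_j)$. 2. In particular, for every $E\in D^b(\mathcal C)$, there is a quasi-isomorphism of dg $k$-algebras (a roof $\mathrm{RHom}_{\mathcal C}(E,E)\leftarrow S\to\mathrm{RHom}_A(\Psi E,\Psi E)$ of dga quasi-isomorphisms) $$\mathrm{RHom}_{\mathcal C}(E,E)\simeq\mathrm{RHom}_A(\Psi E,\Psi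 E).$$ -/

import Mathlib

open CategoryTheory CategoryTheory.Limits

universe t s w w' w'' v u

noncomputable section

/-! ### Linear structure on ind-categories

If `D` is a small abelian category which is linear over a commutative ring `k`, then `Ind D` is
`k`-linear: `r : k` acts on an ind-object, seen as a presheaf on `D`, through the action of `r` on
the objects of `D`. -/

namespace TiltingDG

/-- A morphism out of an ind-object is determined by its restrictions to objects of `D`. -/
lemma ind_hom_ext {D : Type u} [SmallCategory D] {X Y : Ind D} {f g : X ⟶ Y}
    (h : ∀ (c : D) (a : Ind.yoneda.obj c ⟶ X), a ≫ f = a ≫ g) : f = g :=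
  Ind.isSeparating_range_yoneda f g (by
    rintro _ ⟨c⟩ a
    exact h c a)

section Linear

variable (k : Type t) [CommRing k]

lemma asSmall_down_add {C : Type u} [Category.{v} C] [Preadditive C] {X Y : AsSmall.{w} C}
    (f g : X ⟶ Y) : (f + g).down = f.down + g.down :=
  (AsSmall.down (C := C)).map_add

lemma asSmall_down_zero {C : Type u} [Category.{v} C] [Preadditive C] {X Y : AsSmall.{w} C} :
    (0 : X ⟶ Y).down = 0 :=
  (AsSmall.down (C := C)).map_zero X Y

/-- `AsSmall C` is `C` in a larger universe; it inherits a linear structure. -/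
instance linearAsSmall (C : Type u) [Category.{v} C] [Preadditive C] [Linear k C] :
    Linear k (AsSmall.{w} C) where
  homModule X Y :=
    { smul := fun r f => ULift.up (r • f.down)
      one_smul := fun f => ULift.ext _ _ (one_smul k f.down)
      mul_smul := fun r r' f => ULift.ext _ _ (mul_smul r r' f.down)
      smul_zero := fun r => ULift.ext _ _ (by
        rw [asSmall_down_zero]
        exact (congrArg (r • ·) asSmall_down_zero).trans (smul_zero r))
      smul_add := fun r f g => ULift.ext _ _ (by
        rw [asSmall_down_add]
        exact (congrArg (r • ·) (asSmall_down_add f g)).trans (smul_add r f.down g.down))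
      add_smul := fun r r' f => ULift.ext _ _ (by
        rw [asSmall_down_add]
        exact add_smul r r' f.down)
      zero_smul := fun f => ULift.ext _ _ (by
        rw [asSmall_down_zero]
        exact zero_smul k f.down) }
  smul_comp _ _ _ r f g := ULift.ext _ _ (Linear.smul_comp _ _ _ r f.down g.down)
  comp_smul _ _ _ f r g := ULift.ext _ _ (Linear.comp_smul _ _ _ f.down r g.down)

variable {k} {D : Type u} [SmallCategory D] [Abelian D] [Linear k D]

/-- Multiplication by `r : k` on an ind-object. -/
def indScalar (r : k) (X : Ind D) : X ⟶ X :=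
  (Ind.inclusion D).preimage
    { app := fun c => ((Ind.inclusion D).obj X).map (r • 𝟙 c.unop).op
      naturality := fun c c' f => by
        rw [← Functor.map_comp, ← Functor.map_comp]
        congr 1
        apply Quiver.Hom.unop_inj
        simp }

lemma indScalar_comp (r : k) {X Y : Ind D} (f : X ⟶ Y) :
    indScalar r X ≫ f = f ≫ indScalar r Y := by
  apply (Ind.inclusion D).map_injective
  ext c x
  simp [indScalar]

instance indYoneda_additive : (Ind.yoneda (C := D)).Additive :=
  Functor.additive_of_preserves_binary_products _

lemma indScalar_yoneda (r : k) (c : D) :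
    indScalar r (Ind.yoneda.obj c) = Ind.yoneda.map (r • 𝟙 c) := by
  apply (Ind.inclusion D).map_injective
  rw [← cancel_mono ((Ind.yonedaCompInclusion (C := D)).hom.app c)]
  have h := (Ind.yonedaCompInclusion (C := D)).hom.naturality (r • 𝟙 c)
  dsimp only [Functor.comp_map] at h
  rw [h]
  ext d x
  have h' := ConcreteCategory.congr_hom
    (((Ind.yonedaCompInclusion (C := D)).hom.app c).naturality (r • 𝟙 d.unop).op) x
  simp [indScalar] at h' ⊢

lemma indScalar_add (r r' : k) (X : Ind D) :
    indScalar (r + r') X = indScalar r X + indScalar r' X :=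
  ind_hom_ext fun c a => by
    rw [Preadditive.comp_add, ← indScalar_comp, ← indScalar_comp, ← indScalar_comp,
      indScalar_yoneda, indScalar_yoneda, indScalar_yoneda, add_smul, Functor.map_add,
      Preadditive.add_comp]

lemma indScalar_mul (r r' : k) (X : Ind D) :
    indScalar (r * r') X = indScalar r X ≫ indScalar r' X :=
  ind_hom_ext fun c a => by
    rw [← indScalar_comp (r * r'), ← Category.assoc a, ← indScalar_comp r a, Category.assoc,
      ← indScalar_comp r' a, ← Category.assoc, indScalar_yoneda, indScalar_yoneda, indScalar_yoneda, ← Functor.map_comp,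
      Linear.smul_comp, Category.id_comp, smul_smul]

lemma indScalar_one (X : Ind D) : indScalar (1 : k) X = 𝟙 X :=
  ind_hom_ext fun c a => by
    rw [← indScalar_comp, indScalar_yoneda, one_smul, CategoryTheory.Functor.map_id,
      Category.id_comp, Category.comp_id]

lemma indScalar_zero (X : Ind D) : indScalar (0 : k) X = 0 :=
  ind_hom_ext fun c a => by
    rw [← indScalar_comp, indScalar_yoneda, zero_smul, Functor.map_zero, zero_comp, comp_zero]

variable (k) in
instance linearInd : Linear k (Ind D) where
  homModule X Y :=
    { smul := fun r f => indScalar r X ≫ f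
      one_smul := fun f => (congrArg (· ≫ f) (indScalar_one X)).trans (Category.id_comp f)
      mul_smul := fun r r' f => by
        change indScalar (r * r') X ≫ f = indScalar r X ≫ indScalar r' X ≫ f
        rw [indScalar_mul, Category.assoc]
      smul_zero := fun r => comp_zero
      smul_add := fun r f g => Preadditive.comp_add _ _ _ _ _ _
      add_smul := fun r r' f => by
        change indScalar (r + r') X ≫ f = indScalar r X ≫ f + indScalar r' X ≫ f
        rw [indScalar_add, Preadditive.add_comp]
      zero_smul := fun f => (congrArg (· ≫ f) (indScalar_zero X)).trans zero_comp }
  smul_comp _ _ _ r f g := Category.assoc _ _ _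
  comp_smul X Y Z f r g := by
    change f ≫ indScalar r Y ≫ g = indScalar r X ≫ f ≫ g
    rw [← Category.assoc, ← indScalar_comp, Category.assoc]

/-- The embedding `D ⥤ Ind D` is `k`-linear. -/
instance indYoneda_linear : (Ind.yoneda (C := D)).Linear k where
  map_smul {X Y} f r := by
    change Ind.yoneda.map (r • f) = indScalar r (Ind.yoneda.obj X) ≫ Ind.yoneda.map f
    rw [indScalar_yoneda, ← Functor.map_comp, Linear.smul_comp, Category.id_comp]

end Linear

/-! ### Differential graded categories and algebras -/

/-- A differential graded category over `k` with set of objects `ι` (cohomological grading).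
For `f` of degree `p` and `g` of degree `q`, `comp f g` is the composite "`f`, then `g`", i.e. the
composite `g ∘ f`, so that the Leibniz rule `d (g ∘ f) = d g ∘ f + (-1) ^ q • g ∘ d f` takes
the form given in the field `leibniz`. -/
structure DGCategory (k : Type t) [CommRing k] (ι : Type s) where
  Hom : ι → ι → ℤ → Type w
  [addCommGroup : ∀ i j n, AddCommGroup (Hom i j n)]
  [module : ∀ i j n, Module k (Hom i j n)]
  d : ∀ {i j : ι} (n m : ℤ), n + 1 = m → (Hom i j n →ₗ[k] Hom i j m)
  id : ∀ i : ι, Hom i i 0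
  comp : ∀ {i j l : ι} {p q n : ℤ}, p + q = n → (Hom i j p →ₗ[k] Hom j l q →ₗ[k] Hom i l n)
  d_d : ∀ {i j : ι} {n m r : ℤ} (h : n + 1 = m) (h' : m + 1 = r) (x : Hom i j n),
    d m r h' (d n m h x) = 0
  id_comp : ∀ {i j : ι} {n : ℤ} (x : Hom i j n), comp (zero_add n) (id i) x = x
  comp_id : ∀ {i j : ι} {n : ℤ} (x : Hom i j n), comp (add_zero n) x (id j) = x
  assoc : ∀ {i j l m : ι} {p q r pq qr n : ℤ} (hpq : p + q = pq) (hqr : q + r = qr)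
    (h : pq + r = n) (h' : p + qr = n) (x : Hom i j p) (y : Hom j l q) (z : Hom l m r),
    comp h (comp hpq x y) z = comp h' x (comp hqr y z)
  leibniz : ∀ {i j l : ι} {p q n p' q' n' : ℤ} (h : p + q = n) (hp : p + 1 = p')
    (hq : q + 1 = q') (hn : n + 1 = n') (h₁ : p + q' = n') (h₂ : p' + q = n')
    (x : Hom i j p) (y : Hom j l q),
    d n n' hn (comp h x y) = comp h₁ x (d q q' hq y) + q.negOnePow • comp h₂ (d p p' hp x) y

attribute [instance] DGCategory.addCommGroup DGCategory.module

/-- A differential graded `k`-algebra is a differential graded category with one object. -/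
abbrev DGAlgebra (k : Type t) [CommRing k] := DGCategory.{t, 0, w} k PUnit

section DG

variable {k : Type t} [CommRing k] {ι : Type s}

/-- A differential graded functor which is the identity on objects. For differential graded
algebras, this is a morphism of differential graded algebras. -/
structure DGMap (S : DGCategory.{t, s, w} k ι) (R : DGCategory.{t, s, w'} k ι) where
  map : ∀ {i j : ι} {n : ℤ}, S.Hom i j n →ₗ[k] R.Hom i j n
  map_d : ∀ {i j : ι} {n m : ℤ} (h : n + 1 = m) (x : S.Hom i j n),
    map (S.d n m h x) = R.d n m h (map x)
  map_id : ∀ i : ι, map (S.id i) = R.id i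
  map_comp : ∀ {i j l : ι} {p q n : ℤ} (h : p + q = n) (x : S.Hom i j p) (y : S.Hom j l q),
    map (S.comp h x y) = R.comp h (map x) (map y)

/-- A differential graded functor, the identity on objects, is a quasi-isomorphism if it induces
injective and surjective maps on the cohomology of all complexes of morphisms. -/
structure DGMap.IsQuasiIso {S : DGCategory.{t, s, w} k ι} {R : DGCategory.{t, s, w'} k ι}
    (F : DGMap S R) : Prop where
  injective : ∀ {i j : ι} {n m r : ℤ} (h : n + 1 = m) (h' : m + 1 = r) (x : S.Hom i j m),
    S.d m r h' x = 0 → (∃ y : R.Hom i j n, R.d n m h y = F.map x) →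
      ∃ z : S.Hom i j n, S.d n m h z = x
  surjective : ∀ {i j : ι} {n m r : ℤ} (h : n + 1 = m) (h' : m + 1 = r) (y : R.Hom i j m),
    R.d m r h' y = 0 →
      ∃ x : S.Hom i j m, S.d m r h' x = 0 ∧ ∃ z : R.Hom i j n, y = F.map x + R.d n m h z

/-- Two differential graded categories with the same objects (in particular, two differential
graded algebras) are quasi-isomorphic, written `R ≃ R'` in the literature, if they are related by
quasi-isomorphisms `R ⟵ S ⟶ R'`. -/
def DGCategory.QuasiIsomorphic (R R' : DGCategory.{t, s, w} k ι) : Prop :=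
  ∃ (S : DGCategory.{t, s, w} k ι) (F : DGMap S R) (F' : DGMap S R'),
    F.IsQuasiIso ∧ F'.IsQuasiIso

open CochainComplex HomComplex in
variable (k) in
/-- The differential graded category whose objects are the members of a family `K` of complexes:
the complex of morphisms from `K i` to `K j` is the usual total Hom complex. -/
def homDG {𝓖 : Type u} [Category.{v} 𝓖] [Preadditive 𝓖] [Linear k 𝓖]
    (K : ι → CochainComplex 𝓖 ℤ) : DGCategory.{t, s, v} k ι where
  Hom i j n := Cochain (K i) (K j) n
  d n m _ := δ_hom k _ _ n m
  id i := Cochain.ofHom (𝟙 (K i))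
  comp h := LinearMap.mk₂ k (fun x y => x.comp y h)
    (fun _ _ _ => Cochain.add_comp _ _ _ _) (fun _ _ _ => Cochain.smul_comp _ _ _ _)
    (fun _ _ _ => Cochain.comp_add _ _ _ _) (fun _ _ _ => Cochain.comp_smul _ _ _ _)
  d_d _ _ x := δ_δ _ _ _ x
  id_comp x := Cochain.id_comp x
  comp_id x := Cochain.comp_id x
  assoc hpq hqr h _ x y z := Cochain.comp_assoc x y z hpq hqr (by lia)
  leibniz h hp hq hn _ _ x y := δ_comp x y h _ _ _ hn hp hq

end DG

/-! ### Derived endomorphism algebras -/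

section Resolution

variable {𝓖 : Type u} [Category.{v} 𝓖] [Abelian 𝓖] [HasDerivedCategory.{w} 𝓖]

/-- A K-injective resolution of an object of the derived category of `𝓖` (for instance, a bounded
below complex of injectives representing this object). -/
structure KInjectiveResolution (E : DerivedCategory 𝓖) where
  complex : CochainComplex 𝓖 ℤ
  [isKInjective : complex.IsKInjective]
  iso : DerivedCategory.Q.obj complex ≅ E

attribute [instance] KInjectiveResolution.isKInjective

/-- Bounded below objects have K-injective resolutions when there are enough injectives. -/
lemma nonempty_kInjectiveResolution [EnoughInjectives 𝓖] (E : DerivedCategory.Plus 𝓖) :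
    Nonempty (KInjectiveResolution E.obj) := by
  obtain ⟨n, hn⟩ := E.property
  have : E.IsGE n := (DerivedCategory.Plus.isGE_ι_obj_iff E n).1 hn
  obtain ⟨L, _, ⟨e⟩⟩ := DerivedCategory.Plus.exists_injective_nonempty_iso E n
  exact ⟨{ complex := (((InjectiveObject.ι 𝓖).mapHomologicalComplex (.up ℤ)).obj L.obj)
           iso := DerivedCategory.Plus.ι.mapIso e }⟩

variable (k : Type t) [CommRing k] [Linear k 𝓖] {ι : Type s}

/-- The differential graded algebra `RHom(E, E)`, computed by a K-injective resolution of `E`. -/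
def rEnd {E : DerivedCategory 𝓖} (I : KInjectiveResolution E) : DGAlgebra.{t, v} k :=
  homDG k fun _ => I.complex

/-- The differential graded category with morphism complexes `RHom(E i, E j)`, computed by
K-injective resolutions. -/
def rHomDG {E : ι → DerivedCategory 𝓖} (I : ∀ i, KInjectiveResolution (E i)) :
    DGCategory.{t, s, v} k ι :=
  homDG k fun i => (I i).complex

end Resolution

/-! ### The functor `Hom(X, -)` for a complex `X` with an action of a ring -/

section HomFunctor

open CochainComplex HomComplex

variable {𝓖 : Type u} [Category.{v} 𝓖] [Abelian 𝓖] (X : CochainComplex 𝓖 ℤ)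
  {A : Type w} [Ring A] (ρ : A →+* End X)

/-- If `A` acts on `X`, it acts on the right on the cochains from `X` to `Y` by precomposition. -/
@[reducible]
def cochainModule (Y : CochainComplex 𝓖 ℤ) (n : ℤ) : Module Aᵐᵒᵖ (Cochain X Y n) where
  smul a z := (Cochain.ofHom (ρ a.unop)).comp z (zero_add n)
  one_smul z := by
    change (Cochain.ofHom (ρ 1)).comp z (zero_add n) = z
    rw [map_one]
    exact Cochain.id_comp z
  mul_smul a b z := by
    change (Cochain.ofHom (ρ (b.unop * a.unop))).comp z (zero_add n) =
      (Cochain.ofHom (ρ a.unop)).comp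
        ((Cochain.ofHom (ρ b.unop)).comp z (zero_add n)) (zero_add n)
    rw [map_mul, End.mul_def, Cochain.ofHom_comp, Cochain.comp_assoc_of_first_is_zero_cochain]
  smul_zero a := Cochain.comp_zero _ _
  smul_add a z z' := Cochain.comp_add _ _ _ _
  add_smul a b z := by
    change (Cochain.ofHom (ρ (a.unop + b.unop))).comp z (zero_add n) = _
    rw [map_add, Cochain.ofHom_add]
    exact Cochain.add_comp _ _ _ _
  zero_smul z := by
    change (Cochain.ofHom (ρ 0)).comp z (zero_add n) = 0
    rw [map_zero, Cochain.ofHom_zero]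
    exact Cochain.zero_comp _ _

/-- The right `A`-module of cochains of degree `n` from `X` to `Y`. -/
def homModule (Y : CochainComplex 𝓖 ℤ) (n : ℤ) : ModuleCat.{v} Aᵐᵒᵖ :=
  letI := cochainModule X ρ Y n
  ModuleCat.of Aᵐᵒᵖ (Cochain X Y n)

/-- The differential of the Hom complex. -/
def homModuleD (Y : CochainComplex 𝓖 ℤ) (n m : ℤ) : homModule X ρ Y n ⟶ homModule X ρ Y m :=
  letI := cochainModule X ρ Y n
  letI := cochainModule X ρ Y m
  ModuleCat.ofHom
    { toFun := fun z => δ n m z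
      map_add' := fun z z' => δ_add n m z z'
      map_smul' := fun _ _ => δ_ofHom_comp _ _ _ }

/-- Composition of cochains from `X` to `Y` with a fixed cochain from `Y` to `Y'`. -/
def homModuleComp {Y Y' : CochainComplex 𝓖 ℤ} {m : ℤ} (c : Cochain Y Y' m) (n r : ℤ)
    (h : n + m = r) : homModule X ρ Y n ⟶ homModule X ρ Y' r :=
  letI := cochainModule X ρ Y n
  letI := cochainModule X ρ Y' r
  ModuleCat.ofHom
    { toFun := fun z => z.comp c h
      map_add' := fun _ _ => Cochain.add_comp _ _ _ _
      map_smul' := fun _ _ => Cochain.comp_assoc_of_first_is_zero_cochain _ _ _ _ }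

lemma homModule_hom_ext {Y Y' : CochainComplex 𝓖 ℤ} {n m : ℤ}
    {f g : homModule X ρ Y n ⟶ homModule X ρ Y' m}
    (h : ∀ z : Cochain X Y n, f.hom z = g.hom z) : f = g :=
  ModuleCat.hom_ext (LinearMap.ext h)

/-- The total Hom complex from `X` to `Y`, as a complex of right `A`-modules. -/
def homComplexObj (Y : CochainComplex 𝓖 ℤ) : CochainComplex (ModuleCat.{v} Aᵐᵒᵖ) ℤ where
  X n := homModule X ρ Y n
  d n m := homModuleD X ρ Y n m
  shape n m h := homModule_hom_ext X ρ fun z => δ_shape n m h z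
  d_comp_d' n m r _ _ := homModule_hom_ext X ρ fun z => δ_δ n m r z

/-- The functor `Y ↦ Hom(X, Y)` from complexes in `𝓖` to complexes of right `A`-modules. -/
def homComplexFunctor : CochainComplex 𝓖 ℤ ⥤ CochainComplex (ModuleCat.{v} Aᵐᵒᵖ) ℤ where
  obj Y := homComplexObj X ρ Y
  map f :=
    { f := fun n => homModuleComp X ρ (Cochain.ofHom f) n n (add_zero n)
      comm' := fun n m _ => homModule_hom_ext X ρ fun z => δ_comp_ofHom z f m }
  map_id Y := by
    ext1 n
    exact homModule_hom_ext X ρ fun z => Cochain.comp_id z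
  map_comp f g := by
    ext1 n
    refine homModule_hom_ext X ρ fun z => ?_
    exact (congrArg (fun c => z.comp c (add_zero n)) (Cochain.ofHom_comp f g)).trans
      (Cochain.comp_assoc_of_third_is_zero_cochain _ _ _ _).symm

/-- A homotopy between `f` and `g` induces a homotopy between `Hom(X, f)` and `Hom(X, g)`. -/
def homComplexFunctorHomotopy {Y Y' : CochainComplex 𝓖 ℤ} {f g : Y ⟶ Y'} (h : Homotopy f g) :
    Homotopy ((homComplexFunctor X ρ).map f) ((homComplexFunctor X ρ).map g) where
  hom n m :=
    if hnm : n + (-1) = m then homModuleComp X ρ (Cochain.ofHomotopy h) n m hnm else 0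
  zero n m hnm := dif_neg (fun h' => hnm (by simp; lia))
  comm n := by
    rw [dNext_eq _ (show (ComplexShape.up ℤ).Rel n (n + 1) by simp),
      prevD_eq _ (show (ComplexShape.up ℤ).Rel (n - 1) n by simp)]
    have e₁ : n + 1 + (-1) = n := by lia
    have e₂ : n + (-1) = n - 1 := by lia
    refine Eq.trans ?_ (congrArg₂ (fun (a : homModule X ρ Y (n + 1) ⟶ homModule X ρ Y' n)
      (b : homModule X ρ Y n ⟶ homModule X ρ Y' (n - 1)) => homModuleD X ρ Y n (n + 1) ≫ a +
      b ≫ homModuleD X ρ Y' (n - 1) n + homModuleComp X ρ (Cochain.ofHom g) n n (add_zero n))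
      (dif_pos e₁).symm (dif_pos e₂).symm)
    refine homModule_hom_ext X ρ fun z => ?_
    change z.comp (Cochain.ofHom f) (add_zero n) =
      (δ n (n + 1) z).comp (Cochain.ofHomotopy h) e₁ +
        δ (n - 1) n (z.comp (Cochain.ofHomotopy h) e₂) +
      z.comp (Cochain.ofHom g) (add_zero n)
    rw [δ_comp z (Cochain.ofHomotopy h) e₂ (n + 1) 0 n (by lia) rfl (by lia),
      δ_ofHomotopy, Cochain.comp_sub]
    simp

end HomFunctor

/-! ### The functor `RHom(T, -)` -/

section RHom

open DerivedCategory

section Ambient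

variable {𝓖 : Type u} [Category.{v} 𝓖] [Abelian 𝓖]
  (X : CochainComplex 𝓖 ℤ) {A : Type w} [Ring A] (ρ : A →+* End X)
  [HasDerivedCategory.{w'} (ModuleCat.{v} Aᵐᵒᵖ)]

/-- The functor `Y ↦ Hom(X, Y)`, from the homotopy category of `𝓖` to the derived category of
right `A`-modules. -/
def homotopyHomFunctor :
    HomotopyCategory 𝓖 (.up ℤ) ⥤ DerivedCategory (ModuleCat.{v} Aᵐᵒᵖ) :=
  CategoryTheory.Quotient.lift _ (homComplexFunctor X ρ ⋙ Q)
    (fun _ _ _ _ ⟨h⟩ =>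
      DerivedCategory.Q_map_eq_of_homotopy _ (homComplexFunctorHomotopy X ρ h))

/-- The functor `RHom(X, -)`: the right derived functor of `Y ↦ Hom(X, Y)`. -/
def rHomFunctor [EnoughInjectives 𝓖] [HasDerivedCategory.{w''} 𝓖] :
    DerivedCategory.Plus 𝓖 ⥤ DerivedCategory (ModuleCat.{v} Aᵐᵒᵖ) :=
  (HomotopyCategory.Plus.ι 𝓖 ⋙ homotopyHomFunctor X ρ).totalRightDerived
    Plus.Qh (HomotopyCategory.Plus.quasiIso 𝓖)

end Ambient

section Tilting

variable (C : Type u) [Category.{v} C] [Abelian C]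

/-- The category of ind-objects of `C`. In order to cover all abelian categories, `C` is first
replaced by the equivalent category `AsSmall C`, which is small in a larger universe. The category
`IndCat C` is a Grothendieck abelian category and `C` is an exact full subcategory of it. -/
abbrev IndCat : Type (max u v + 1) := Ind (AsSmall.{max u v} C)

/-- The embedding of `C` in its category of ind-objects. -/
abbrev toInd : C ⥤ IndCat C := AsSmall.up ⋙ Ind.yoneda

instance full_toInd : (toInd C).Full :=
  have : (AsSmall.up (C := C)).Full := inferInstanceAs (AsSmall.equiv (C := C)).functor.Full
  inferInstance

instance faithful_toInd : (toInd C).Faithful :=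
  have : (AsSmall.up (C := C)).Faithful :=
    inferInstanceAs (AsSmall.equiv (C := C)).functor.Faithful
  inferInstance

instance preservesFiniteLimits_toInd : PreservesFiniteLimits (toInd C) :=
  have : PreservesFiniteLimits (AsSmall.up (C := C)) :=
    inferInstanceAs (PreservesFiniteLimits (AsSmall.equiv (C := C)).functor)
  have : PreservesFiniteLimits (Ind.yoneda (C := AsSmall.{max u v} C)) :=
    PreservesLimits.preservesFiniteLimits _
  comp_preservesFiniteLimits _ _

instance preservesFiniteColimits_toInd : PreservesFiniteColimits (toInd C) :=
  have : PreservesFiniteColimits (AsSmall.up (C := C)) :=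
    inferInstanceAs (PreservesFiniteColimits (AsSmall.equiv (C := C)).functor)
  comp_preservesFiniteColimits _ _

instance linear_toInd (k : Type t) [CommRing k] [Linear k C] : (toInd C).Linear k :=
  have : (AsSmall.up (C := C)).Linear k := { map_smul := fun _ _ => rfl }
  inferInstance

variable [HasDerivedCategory.{max u v} C] [HasDerivedCategory.{w} (IndCat C)]

/-- The (exact) embedding of `C` in its category of ind-objects induces an embedding of
`D^b(C)` in the bounded below derived category of ind-objects. -/
def boundedToInd : DerivedCategory.Bounded C ⥤ DerivedCategory.Plus (IndCat C) :=
  ObjectProperty.lift _ (Bounded.ι ⋙ (toInd C).mapDerivedCategory) (by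
    rintro ⟨E, ⟨n, K, e, hK⟩, _⟩
    exact ⟨n, ((toInd C).mapHomologicalComplex (.up ℤ)).obj K,
      (toInd C).mapDerivedCategory.mapIso e ≪≫ (toInd C).mapDerivedCategoryFactors.app K,
      inferInstance⟩)

variable {C} in
/-- Let `T` be an object of `D^b(C)` and `A = End(T)`. A model of `T` is a complex of ind-objects
representing `T`, on which `A` acts, in such a way that this action induces the tautological
action of `A` on `T`.

If `T` is an object of `C`, then `T` itself, in degree `0`, is a model. In general, a model is
what is needed in order to see the functor `RHom(T, -)` as a functor with values in the derived
category of right `A`-modules. -/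
structure Model (k : Type t) [CommRing k] [Linear k C] (T : DerivedCategory.Bounded C) where
  complex : CochainComplex (IndCat C) ℤ
  action : End T →ₐ[k] End complex
  iso : Q.obj complex ≅ ((boundedToInd C).obj T).obj
  comm : ∀ a : End T, Q.map (action a) ≫ iso.hom = iso.hom ≫ ((boundedToInd C).map a).hom

variable {C}

namespace Model

variable {k : Type t} [CommRing k] [Linear k C] {T : DerivedCategory.Bounded C} (X : Model k T)
  [HasDerivedCategory.{w'} (ModuleCat.{max u v} (End T)ᵐᵒᵖ)]

/-- The functor `Ψ = RHom(T, -)` from `D^b(C)` to the derived category of right modules over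
`A = End(T)` (that is, left modules over the opposite ring). -/
def rHom : DerivedCategory.Bounded C ⥤ DerivedCategory (ModuleCat.{max u v} (End T)ᵐᵒᵖ) :=
  boundedToInd C ⋙ rHomFunctor X.complex X.action.toRingHom

/-- The objects of `D^b_𝓜(R)`: the bounded complexes of `R`-modules whose cohomology modules
belong to the class `𝓜`. For the class of all modules this is the usual bounded derived category
of `R`-modules; for the finitely generated modules over a noetherian ring, it is the usual bounded
derived category of finitely generated modules. -/
def boundedDerived {R : Type w} [Ring R] [HasDerivedCategory.{w'} (ModuleCat.{v} R)]
    (𝓜 : ObjectProperty (ModuleCat.{v} R)) : ObjectProperty (DerivedCategory (ModuleCat.{v} R)) :=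
  fun M => TStructure.t.bounded M ∧ ∀ n : ℤ, 𝓜 ((homologyFunctor (ModuleCat.{v} R) n).obj M)

/-- `T` is a tilting object of `D^b(C)`: the functor `RHom(T, -)` is an equivalence from `D^b(C)`
to the bounded derived category `D^b(A)`, where `A = End(T)`. Here `𝓜` is the class of right
`A`-modules, containing `A`, out of which `D^b(A)` is formed. -/
structure IsTilting (𝓜 : ObjectProperty (ModuleCat.{max u v} (End T)ᵐᵒᵖ)) : Prop where
  regular_mem : 𝓜 (ModuleCat.of (End T)ᵐᵒᵖ (End T)ᵐᵒᵖ)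
  full : X.rHom.Full
  faithful : X.rHom.Faithful
  essImage_eq : X.rHom.essImage = boundedDerived 𝓜

/-- The objects `Ψ E` have K-injective resolutions. -/
lemma IsTilting.nonempty_kInjectiveResolution_rHom {X : Model k T}
    {𝓜 : ObjectProperty (ModuleCat.{max u v} (End T)ᵐᵒᵖ)} (h : X.IsTilting 𝓜)
    (E : DerivedCategory.Bounded C) : Nonempty (KInjectiveResolution (X.rHom.obj E)) := by
  have hE : boundedDerived 𝓜 (X.rHom.obj E) := by
    rw [← h.essImage_eq]
    exact X.rHom.obj_mem_essImage E
  exact nonempty_kInjectiveResolution ⟨X.rHom.obj E, hE.1.1⟩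

open scoped ModuleCat.Algebra in
/-- The functor `Ψ = RHom(T, -)` is compatible with the differential graded structures: for any
family `E i` of objects of `D^b(C)`, the differential graded categories with morphism complexes
`RHom_C(E i, E j)` and `RHom_A(Ψ (E i), Ψ (E j))` (computed with arbitrary K-injective resolutions)
are related by quasi-isomorphisms `RHom_C ⟵ S ⟶ RHom_A` which induce
`Ψ : Hom(E i, E j) ⟶ Hom(Ψ (E i), Ψ (E j))` on cohomology in degree `0`.

For an equivalence `Ψ` and the family of all objects of `D^b(C)`, this says that `Ψ` lifts to an
equivalence of differential graded enhancements. -/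
def IsDGEquivalence : Prop :=
  ∀ (ι : Type s) (E : ι → DerivedCategory.Bounded C)
    (I : ∀ i, KInjectiveResolution ((boundedToInd C).obj (E i)).obj)
    (J : ∀ i, KInjectiveResolution (X.rHom.obj (E i))),
    ∃ (S : DGCategory.{t, s, max u v} k ι) (F : DGMap S (rHomDG k I)) (G : DGMap S (rHomDG k J)),
      F.IsQuasiIso ∧ G.IsQuasiIso ∧
      ∀ (i j : ι) (x : S.Hom i j 0) (f : E i ⟶ E j)
        (a : (I i).complex ⟶ (I j).complex) (b : (J i).complex ⟶ (J j).complex),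
        S.d 0 1 (zero_add 1) x = 0 →
        F.map x = CochainComplex.HomComplex.Cochain.ofHom a →
        G.map x = CochainComplex.HomComplex.Cochain.ofHom b →
        Q.map a ≫ (I j).iso.hom = (I i).iso.hom ≫ ((boundedToInd C).map f).hom →
        Q.map b ≫ (J j).iso.hom = (J i).iso.hom ≫ X.rHom.map f

open scoped ModuleCat.Algebra in
/-- For the object `E` of `D^b(C)`, the differential graded algebras `RHom_C(E, E)` and
`RHom_A(Ψ E, Ψ E)` (computed with arbitrary K-injective resolutions) are quasi-isomorphic. -/
def REndQuasiIsomorphic (E : DerivedCategory.Bounded C) : Prop :=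
  ∀ (I : KInjectiveResolution ((boundedToInd C).obj E).obj)
    (J : KInjectiveResolution (X.rHom.obj E)),
    (rEnd k I).QuasiIsomorphic (rEnd k J)

end Model

end Tilting

end RHom

end TiltingDG

end

/-! Full faithfulness of `Ψ` drives the argument. Let `I i` and `J i` be K-injective resolutions of
`E i` and `Ψ (E i)`. Since `Ψ` is computed by `Hom(X, -)` on K-injective complexes, there are
quasi-isomorphisms `q i : Hom(X, I i) ⟶ J i`. Postcomposition makes `Hom(X, -)` a dg functor on the
`I i`, but it lands in morphisms between the `Hom(X, I i)`, which need not be K-injective. The roof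
is therefore the homotopy pullback of `Hom(I i, I j) ⟶ Hom(Hom(X, I i), J j) ⟵ Hom(J i, J j)`, whose
morphisms are triples: one morphism on each side and a homotopy between their images. Each
projection is a quasi-isomorphism as soon as the opposite leg of this cospan is one.

The right leg is precomposition with `q i`, a quasi-isomorphism because `J j` is K-injective. On
cohomology in degree `m`, the left leg is the map from `Hom(I i, (I j)⟦m⟧)` to `Hom(Hom(X, I i),
Hom(X, (I j)⟦m⟧))` in the derived categories. Fullness and faithfulness of `Ψ` give bijectivity,
once morphisms between the `I i` in the derived category of ind-objects are known to come from
`D^b(C)`.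

This last point is the fullness of `boundedToInd`. Its faithfulness is inherited from `Ψ`, which
factors through it. By a four lemma and truncation, fullness reduces to surjectivity on `Ext` groups
(`mapExactFunctor_surjective`): with enough injectives, a class of positive degree is killed by an
epimorphism of ind-objects, and such an epimorphism onto an object of `C` is dominated by an
epimorphism in `C` (`exists_epi_yoneda_comp`), so that dimension shifting can take place inside `C`.

Finally, a closed triple of degree `0` is a square commuting up to homotopy, which identifies the
map on `H^0` with `Ψ`. -/

noncomputable section

namespace TiltingDG

section

open CochainComplex HomComplex

/-! ### The homotopy pullback as a dg category. -/

section HomotopyPullback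

variable {k : Type t} [CommRing k] {ι : Type s} {𝓗 : Type u} [Category.{v} 𝓗] [Preadditive 𝓗]
  [Linear k 𝓗] {R : DGCategory.{t, s, v} k ι} {P J : ι → CochainComplex 𝓗 ℤ}

/-- The action on the complexes `P i` given by a differential graded functor. -/
def act (Φ : DGMap R (homDG k P)) {i j : ι} {n : ℤ} : R.Hom i j n →ₗ[k] Cochain (P i) (P j) n :=
  Φ.map

/-- The complexes of morphisms `R.Hom i j` act on the complexes `P j`; composing the action with
`q j : P j ⟶ J j` gives cochains from `P i` to `J j`. -/
def actComp (Φ : DGMap R (homDG k P)) (q : ∀ i, P i ⟶ J i) {i j : ι} {n m : ℤ} (h : n + 0 = m) :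
    R.Hom i j n →ₗ[k] Cochain (P i) (J j) m :=
  { toFun := fun z : Cochain (P i) (P j) n => z.comp (Cochain.ofHom (q j)) h
    map_add' := fun _ _ => Cochain.add_comp _ _ _ _
    map_smul' := fun _ _ => Cochain.smul_comp _ _ _ _ } ∘ₗ act Φ

/-- Precomposition of cochains with `q i : P i ⟶ J i`. -/
def precompQ (k : Type t) [CommRing k] [Linear k 𝓗] (q : ∀ i, P i ⟶ J i) {i j : ι} {n m : ℤ}
    (h : 0 + n = m) : Cochain (J i) (J j) n →ₗ[k] Cochain (P i) (J j) m where
  toFun z := (Cochain.ofHom (q i)).comp z h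
  map_add' _ _ := Cochain.comp_add _ _ _ _
  map_smul' _ _ := Cochain.comp_smul _ _ _ _

variable (Φ : DGMap R (homDG k P)) (q : ∀ i, P i ⟶ J i)

lemma actComp_apply {i j : ι} {n m : ℤ} (h : n + 0 = m) (x : R.Hom i j n) :
    actComp Φ q h x = Cochain.comp (act Φ x) (Cochain.ofHom (q j)) h := rfl

lemma precompQ_apply {i j : ι} {n m : ℤ} (h : 0 + n = m) (x : Cochain (J i) (J j) n) :
    precompQ k q h x = (Cochain.ofHom (q i)).comp x h := rfl

lemma act_d {i j : ι} {n m : ℤ} (h : n + 1 = m) (x : R.Hom i j n) :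
    (act Φ (R.d n m h x)) = δ n m (act Φ x) :=
  Φ.map_d h x

lemma act_comp {i j l : ι} {p r n : ℤ} (h : p + r = n) (x : R.Hom i j p) (y : R.Hom j l r) :
    (act Φ (R.comp h x y)) =
      Cochain.comp (act Φ x) (act Φ y) h :=
  Φ.map_comp h x y

lemma act_id (i : ι) :
    (act Φ (R.id i)) = Cochain.ofHom (𝟙 (P i)) :=
  Φ.map_id i

lemma δ_actComp {i j : ι} {n m n' m' : ℤ} (h : n + 0 = m) (hn : n + 1 = n') (h' : n' + 0 = m')
    (x : R.Hom i j n) :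
    δ m m' (actComp Φ q h x) = actComp Φ q h' (R.d n n' hn x) := by
  obtain rfl : n = m := by lia
  obtain rfl : n' = m' := by lia
  rw [actComp_apply, actComp_apply, δ_comp_ofHom, act_d]

lemma δ_precompQ {i j : ι} {n m n' m' : ℤ} (h : 0 + n = m) (h' : 0 + n' = m')
    (x : Cochain (J i) (J j) n) :
    δ m m' (precompQ k q h x) = precompQ k q h' (δ n n' x) := by
  obtain rfl : n = m := by lia
  obtain rfl : n' = m' := by lia
  rw [precompQ_apply, precompQ_apply, δ_ofHom_comp]

/-- The homotopy pullback of the morphisms of complexes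
`R.Hom i j ⟶ Hom(P i, J j) ⟵ Hom(J i, J j)`. -/
abbrev PullbackHom (R : DGCategory.{t, s, v} k ι) (P J : ι → CochainComplex 𝓗 ℤ)
    (i j : ι) (n : ℤ) : Type v :=
  R.Hom i j n × Cochain (J i) (J j) n × Cochain (P i) (J j) (n - 1)

/-- The differential of the homotopy pullback. -/
def pullbackD {i j : ι} (n m : ℤ) (h : n + 1 = m) :
    PullbackHom R P J i j n →ₗ[k] PullbackHom R P J i j m :=
  LinearMap.prod (R.d n m h ∘ₗ LinearMap.fst k _ _)
    (LinearMap.prod (δ_hom k _ _ n m ∘ₗ LinearMap.fst k _ _ ∘ₗ LinearMap.snd k _ _)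
      (actComp Φ q (by lia) ∘ₗ LinearMap.fst k _ _ -
        precompQ k q (by lia) ∘ₗ LinearMap.fst k _ _ ∘ₗ LinearMap.snd k _ _ -
        δ_hom k _ _ (n - 1) (m - 1) ∘ₗ LinearMap.snd k _ _ ∘ₗ LinearMap.snd k _ _))

lemma pullbackD_apply {i j : ι} (n m : ℤ) (h : n + 1 = m) (x : PullbackHom R P J i j n) :
    pullbackD Φ q n m h x = (R.d n m h x.1, δ n m x.2.1,
      actComp Φ q (by lia) x.1 - precompQ k q (by lia) x.2.1 - δ (n - 1) (m - 1) x.2.2) := rfl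

/-- The composition in the homotopy pullback. -/
def pullbackComp {i j l : ι} {p r n : ℤ} (h : p + r = n) :
    PullbackHom R P J i j p →ₗ[k] PullbackHom R P J j l r →ₗ[k] PullbackHom R P J i l n :=
  LinearMap.mk₂ k (fun x y => (R.comp h x.1 y.1, x.2.1.comp y.2.1 h,
      Cochain.comp (act Φ x.1) y.2.2 (by lia) +
        r.negOnePow • x.2.2.comp y.2.1 (by lia)))
    (fun x x' y => by
      ext1
      · simp
      ext1
      · exact Cochain.add_comp _ _ _ h
      · change Cochain.comp (act Φ (x.1 + x'.1)) y.2.2 (by lia) +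
          r.negOnePow • (x.2.2 + x'.2.2).comp y.2.1 (by lia) = _
        rw [map_add, Cochain.add_comp, Cochain.add_comp, smul_add]
        exact add_add_add_comm _ _ _ _)
    (fun c x y => by
      ext1
      · simp
      ext1
      · exact Cochain.smul_comp _ _ _ h
      · change Cochain.comp (act Φ (c • x.1)) y.2.2 (by lia) +
          r.negOnePow • (c • x.2.2).comp y.2.1 (by lia) = c • (_ + _)
        rw [map_smul, smul_add, smul_comm c, Cochain.smul_comp, Cochain.smul_comp])
    (fun x y y' => by
      ext1
      · simp
      ext1
      · exact Cochain.comp_add _ _ _ h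
      · change Cochain.comp (act Φ x.1) (y.2.2 + y'.2.2) (by lia) +
          r.negOnePow • x.2.2.comp (y.2.1 + y'.2.1) (by lia) = _
        rw [Cochain.comp_add, Cochain.comp_add, smul_add]
        exact add_add_add_comm _ _ _ _)
    (fun c x y => by
      ext1
      · simp
      ext1
      · exact Cochain.comp_smul _ _ _ h
      · change Cochain.comp (act Φ x.1) (c • y.2.2) (by lia) +
          r.negOnePow • x.2.2.comp (c • y.2.1) (by lia) = c • (_ + _)
        rw [smul_add, smul_comm c, Cochain.comp_smul, Cochain.comp_smul])

/-- Only the homotopy component requires work. The sign `(-1) ^ r` in `pullbackComp` is chosen so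
that the two mixed terms `Φ(f) ≫ q ≫ g'` cancel, leaving the difference of the images of the two
composites. -/
lemma pullback_leibniz {i j l : ι} {p r n p' r' n' : ℤ} (h : p + r = n) (hp : p + 1 = p')
    (hr : r + 1 = r') (hn : n + 1 = n') (h₁ : p + r' = n') (h₂ : p' + r = n')
    (x : PullbackHom R P J i j p) (y : PullbackHom R P J j l r) :
    pullbackD Φ q n n' hn (pullbackComp Φ h x y) =
      pullbackComp Φ h₁ x (pullbackD Φ q r r' hr y) +
        r.negOnePow • pullbackComp Φ h₂ (pullbackD Φ q p p' hp x) y := by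
  ext1
  · exact R.leibniz h hp hr hn h₁ h₂ x.1 y.1
  ext1
  · exact δ_comp x.2.1 y.2.1 h _ _ _ hn hp hr
  obtain ⟨f, g, z⟩ := x
  obtain ⟨f', g', z'⟩ := y
  change actComp Φ q (by lia) (R.comp h f f') - precompQ k q (by lia) (g.comp g' h) -
      δ (n - 1) (n' - 1) (Cochain.comp (act Φ f) z' (by lia) +
        r.negOnePow • z.comp g' (by lia)) =
    (Cochain.comp (act Φ f)
        (actComp Φ q (by lia) f' - precompQ k q (by lia) g' - δ (r - 1) (r' - 1) z') (by lia) +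
      r'.negOnePow • z.comp (δ r r' g') (by lia)) +
    r.negOnePow • (Cochain.comp (act Φ (R.d p p' hp f)) z' (by lia) +
      r.negOnePow • Cochain.comp (actComp Φ q (by lia) f - precompQ k q (by lia) g - δ (p - 1) (p' - 1) z) g' (by lia))
  have e₁ : r'.negOnePow = - r.negOnePow := by rw [← hr, Int.negOnePow_succ]
  have e₂ : (r - 1).negOnePow = - r.negOnePow := by rw [Int.negOnePow_sub, Int.negOnePow_one]; simp
  rw [δ_add, δ_units_smul, δ_comp _ z' (by lia) p' (r' - 1) (n' - 1) (by lia) hp (by lia),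
    δ_comp z g' (by lia) (p' - 1) r' (n' - 1) (by lia) (by lia) hr, act_d, e₁, e₂]
  simp only [actComp_apply, precompQ_apply, act_comp, Cochain.comp_sub, Cochain.sub_comp,
    smul_add, smul_sub, smul_smul, Int.units_mul_self, one_smul, Units.neg_smul]
  rw [Cochain.comp_assoc (act Φ f) (act Φ f') (Cochain.ofHom (q l)) h
      (show r + 0 = r' - 1 by lia) (by lia),
    Cochain.comp_assoc (act Φ f) (Cochain.ofHom (q j)) g' (show p + 0 = p' - 1 by lia)
      (show 0 + r = r' - 1 by lia) (by lia),
    Cochain.comp_assoc (Cochain.ofHom (q i)) g g' (show 0 + p = p' - 1 by lia) h (by lia)]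
  abel

/-- The homotopy pullback of a differential graded functor `R ⟶ Hom(P, P)` and of `Hom(J, J)` along
a family of morphisms `q i : P i ⟶ J i`. A morphism is a triple `(f, g, z)`, where `f` is
a morphism in `R`, where `g` is a cochain from `J i` to `J j`, and `z` is a homotopy between the two
cochains from `P i` to `J j` deduced from `f` and `g`. -/
def homotopyPullback : DGCategory.{t, s, v} k ι where
  Hom := PullbackHom R P J
  d n m h := pullbackD Φ q n m h
  id i := (R.id i, Cochain.ofHom (𝟙 (J i)), 0)
  comp h := pullbackComp Φ h
  d_d {i j n m r} h h' x := by
    obtain ⟨f, g, z⟩ := x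
    ext1
    · exact R.d_d h h' _
    ext1
    · exact δ_δ _ _ _ _
    change actComp Φ q (by lia) (R.d n m h f) - precompQ k q (by lia) (δ n m g) - δ (m - 1) (r - 1)
      (actComp Φ q (by lia) f - precompQ k q (by lia) g - δ (n - 1) (m - 1) z) = 0
    rw [δ_sub, δ_sub, δ_δ _ _ _ z, δ_actComp Φ q (by lia) h (by lia),
      δ_precompQ q (by lia) (show 0 + m = r - 1 by lia), sub_zero, sub_self]
  id_comp {i j n} x := by
    obtain ⟨f, g, z⟩ := x
    ext1
    · exact R.id_comp _
    ext1
    · exact Cochain.id_comp _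
    change Cochain.comp (act Φ (R.id i)) z (by lia) +
      n.negOnePow • Cochain.comp (0 : Cochain (P i) (J i) (0 - 1)) g (by lia) = z
    rw [act_id, Cochain.id_comp, Cochain.zero_comp, smul_zero, add_zero]
  comp_id {i j n} x := by
    obtain ⟨f, g, z⟩ := x
    ext1
    · exact R.comp_id _
    ext1
    · exact Cochain.comp_id _
    change Cochain.comp (act Φ f) (0 : Cochain (P j) (J j) (0 - 1)) (by lia) +
      Int.negOnePow 0 • z.comp (Cochain.ofHom (𝟙 (J j))) (by lia) = z
    rw [Cochain.comp_id, Cochain.comp_zero, Int.negOnePow_zero, one_smul, zero_add]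
  assoc {i j l m p r s pr rs n} hpr hrs h h' x y z := by
    obtain ⟨f, g, a⟩ := x
    obtain ⟨f', g', a'⟩ := y
    obtain ⟨f'', g'', a''⟩ := z
    ext1
    · exact R.assoc hpr hrs h h' _ _ _
    ext1
    · exact Cochain.comp_assoc _ _ _ hpr hrs (by lia)
    change Cochain.comp (act Φ (R.comp hpr f f')) a'' (by lia) +
        s.negOnePow • Cochain.comp (Cochain.comp (act Φ f) a' (by lia) +
          r.negOnePow • a.comp g' (by lia)) g'' (by lia) =
      Cochain.comp (act Φ f)
        (Cochain.comp (act Φ f' : Cochain (P j) (P l) r) a'' (by lia) + s.negOnePow • a'.comp g'' (by lia)) _ +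
      rs.negOnePow • a.comp (g'.comp g'' hrs) (by lia)
    rw [act_comp, show rs.negOnePow = r.negOnePow * s.negOnePow by rw [← hrs, Int.negOnePow_add]]
    simp only [Cochain.comp_add, Cochain.add_comp, Cochain.comp_units_smul,
      Cochain.units_smul_comp, smul_add, smul_smul]
    rw [Cochain.comp_assoc _ _ a'' hpr (show r + (s - 1) = rs - 1 by lia) (by lia),
      Cochain.comp_assoc _ a' g'' (show p + (r - 1) = pr - 1 by lia)
        (show r - 1 + s = rs - 1 by lia) (by lia),
      Cochain.comp_assoc a g' g'' (show p - 1 + r = pr - 1 by lia) hrs (by lia),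
      mul_comm, add_assoc]
  leibniz h hp hr hn h₁ h₂ x y := pullback_leibniz Φ q h hp hr hn h₁ h₂ x y

/-- The projection of the homotopy pullback to its first factor. -/
def homotopyPullbackFst : DGMap (homotopyPullback Φ q) R where
  map {i j n} := LinearMap.fst k (R.Hom i j n)
    (Cochain (J i) (J j) n × Cochain (P i) (J j) (n - 1))
  map_d _ _ := rfl
  map_id _ := rfl
  map_comp _ _ _ := rfl

/-- The projection of the homotopy pullback to its second factor. -/
def homotopyPullbackSnd : DGMap (homotopyPullback Φ q) (homDG k J) where
  map {i j n} := LinearMap.fst k (Cochain (J i) (J j) n) (Cochain (P i) (J j) (n - 1)) ∘ₗ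
    LinearMap.snd k (R.Hom i j n) _
  map_d _ _ := rfl
  map_id _ := rfl
  map_comp _ _ _ := rfl

end HomotopyPullback

end

section

open CochainComplex HomComplex

/-! ### When the projections of the homotopy pullback are quasi-isomorphisms. -/

section HomotopyPullback

variable {k : Type t} [CommRing k] {ι : Type s} {𝓗 : Type u} [Category.{v} 𝓗] [Preadditive 𝓗]
  [Linear k 𝓗] {R : DGCategory.{t, s, v} k ι} {P J : ι → CochainComplex 𝓗 ℤ}
  (Φ : DGMap R (homDG k P)) (q : ∀ i, P i ⟶ J i)

lemma pullbackD_eq_iff {i j : ι} {n m : ℤ} (h : n + 1 = m) (x : PullbackHom R P J i j n)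
    (y : PullbackHom R P J i j m) :
    pullbackD Φ q n m h x = y ↔ R.d n m h x.1 = y.1 ∧ δ n m x.2.1 = y.2.1 ∧
      actComp Φ q (by lia) x.1 - precompQ k q (by lia) x.2.1 - δ (n - 1) (m - 1) x.2.2 = y.2.2 := by
  rw [pullbackD_apply, Prod.ext_iff, Prod.ext_iff]

/-- The projection to the first factor is a quasi-isomorphism if precomposition with the
morphisms `q i` is. -/
lemma homotopyPullbackFst_isQuasiIso
    (inj : ∀ {i j : ι} {n m r : ℤ} (_ : n + 1 = m) (_ : m + 1 = r) (g : Cochain (J i) (J j) m),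
      δ m r g = 0 → (∃ z, δ n m z = precompQ k q (zero_add m) g) → ∃ g', δ n m g' = g)
    (surj : ∀ {i j : ι} {n m r : ℤ} (_ : n + 1 = m) (_ : m + 1 = r) (y : Cochain (P i) (J j) m),
      δ m r y = 0 → ∃ g, δ m r g = 0 ∧ ∃ z, y = precompQ k q (zero_add m) g + δ n m z) :
    (homotopyPullbackFst Φ q).IsQuasiIso where
  injective {i j n m r} h h' x hx := by
    rintro ⟨f₀, hf₀⟩
    obtain ⟨f, g, z⟩ := x
    obtain ⟨-, hg, hz⟩ := (pullbackD_eq_iff Φ q h' _ _).1 hx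
    change R.d n m h f₀ = f at hf₀
    -- The homotopy component of a morphism of degree `r` has degree `r - 1`. Expressing all degrees
    -- through `r` makes these types agree without transport.
    obtain rfl : m = r - 1 := by lia
    obtain rfl : n = r - 1 - 1 := by lia
    replace hg : δ (r - 1) r g = 0 := hg
    replace hz : actComp Φ q (add_zero _) f - precompQ k q (zero_add _) g -
      δ (r - 1 - 1) (r - 1) z = 0 := hz
    have hδ := δ_actComp Φ q (add_zero _) h (add_zero _) f₀
    rw [hf₀] at hδ
    obtain ⟨g₁, hg₁⟩ := inj h h' g hg ⟨actComp Φ q (add_zero _) f₀ - z, by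
      rw [δ_sub, hδ, ← sub_eq_zero, ← hz]
      abel⟩
    have hδ' := δ_precompQ (k := k) q (zero_add (r - 1 - 1)) (zero_add (r - 1)) g₁
    rw [hg₁] at hδ'
    -- The primitives `f₀` and `g₁` need not be compatible with the homotopy `z`: the defect is a
    -- cocycle. Surjectivity one degree lower writes it as the image of a cocycle `u` plus a
    -- coboundary, and `u` is absorbed into `g₁`.
    obtain ⟨u, hu, v, hv⟩ := surj (sub_add_cancel (r - 1 - 1) 1) h
      (actComp Φ q (add_zero _) f₀ - precompQ k q (zero_add _) g₁ - z) (by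
        rw [δ_sub, δ_sub, hδ, hδ', hz])
    refine ⟨(f₀, g₁ + u, v), (pullbackD_eq_iff Φ q h _ _).2 ⟨hf₀, ?_, ?_⟩⟩
    · change δ (r - 1 - 1) (r - 1) (g₁ + u) = g
      rw [δ_add, hg₁, hu, add_zero]
    · change actComp Φ q (add_zero _) f₀ - precompQ k q (zero_add _) (g₁ + u) -
        δ (r - 1 - 1 - 1) (r - 1 - 1) v = z
      rw [map_add, ← sub_sub, sub_sub _ (precompQ k q (zero_add _) u), ← hv, sub_sub_cancel]
  surjective {i j n m r} h h' f hf := by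
    obtain rfl : m = r - 1 := by lia
    obtain rfl : n = r - 1 - 1 := by lia
    have hδ := δ_actComp Φ q (add_zero _) h' (add_zero _) f
    rw [hf, map_zero] at hδ
    obtain ⟨g, hg, z, hz⟩ := surj h h' _ hδ
    refine ⟨(f, g, z), (pullbackD_eq_iff Φ q h' _ _).2 ⟨hf, hg, ?_⟩, 0, ?_⟩
    · change actComp Φ q (add_zero _) f - precompQ k q (zero_add _) g -
        δ (r - 1 - 1) (r - 1) z = 0
      rw [hz]
      abel
    · rw [map_zero, add_zero]
      rfl

/-- The projection to the second factor is a quasi-isomorphism if the morphisms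
`R.Hom i j ⟶ Hom(P i, J j)` are. -/
lemma homotopyPullbackSnd_isQuasiIso
    (inj : ∀ {i j : ι} {n m r : ℤ} (h : n + 1 = m) (h' : m + 1 = r) (f : R.Hom i j m),
      R.d m r h' f = 0 → (∃ z, δ n m z = actComp Φ q (add_zero m) f) →
        ∃ f', R.d n m h f' = f)
    (surj : ∀ {i j : ι} {n m r : ℤ} (_ : n + 1 = m) (h' : m + 1 = r) (y : Cochain (P i) (J j) m),
      δ m r y = 0 → ∃ f, R.d m r h' f = 0 ∧ ∃ z, y = actComp Φ q (add_zero m) f + δ n m z) :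
    (homotopyPullbackSnd Φ q).IsQuasiIso where
  injective {i j n m r} h h' x hx := by
    rintro ⟨g₀, hg₀⟩
    obtain ⟨f, g, z⟩ := x
    obtain ⟨hf, -, hz⟩ := (pullbackD_eq_iff Φ q h' _ _).1 hx
    change δ n m g₀ = g at hg₀
    obtain rfl : m = r - 1 := by lia
    obtain rfl : n = r - 1 - 1 := by lia
    replace hf : R.d (r - 1) r h' f = 0 := hf
    replace hz : actComp Φ q (add_zero _) f - precompQ k q (zero_add _) g -
      δ (r - 1 - 1) (r - 1) z = 0 := hz
    have hδ := δ_precompQ (k := k) q (zero_add (r - 1 - 1)) (zero_add (r - 1)) g₀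
    rw [hg₀] at hδ
    obtain ⟨f₁, hf₁⟩ := inj h h' f hf ⟨precompQ k q (zero_add _) g₀ + z, by
      rw [δ_add, hδ, eq_comm, ← sub_eq_zero, ← hz]
      abel⟩
    have hδ' := δ_actComp Φ q (add_zero _) h (add_zero _) f₁
    rw [hf₁] at hδ'
    -- Here the defect is corrected on the side of `R`. It is taken with the opposite sign, so the
    -- homotopy becomes `-v`.
    obtain ⟨u, hu, v, hv⟩ := surj (sub_add_cancel (r - 1 - 1) 1) h
      (z - (actComp Φ q (add_zero _) f₁ - precompQ k q (zero_add _) g₀)) (by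
        rw [δ_sub, δ_sub, hδ, hδ', sub_eq_zero]
        exact (sub_eq_zero.1 hz).symm)
    refine ⟨(f₁ + u, g₀, -v), (pullbackD_eq_iff Φ q h _ _).2 ⟨?_, hg₀, ?_⟩⟩
    · change R.d (r - 1 - 1) (r - 1) h (f₁ + u) = f
      rw [map_add, hf₁, hu, add_zero]
    · change actComp Φ q (add_zero _) (f₁ + u) - precompQ k q (zero_add _) g₀ -
        δ (r - 1 - 1 - 1) (r - 1 - 1) (-v) = z
      rw [map_add, δ_neg, sub_eq_iff_eq_add.1 hv]
      abel
  surjective {i j n m r} h h' g hg := by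
    obtain rfl : m = r - 1 := by lia
    obtain rfl : n = r - 1 - 1 := by lia
    replace hg : δ (r - 1) r g = 0 := hg
    have hδ := δ_precompQ (k := k) q (zero_add (r - 1)) (zero_add r) g
    rw [hg, map_zero] at hδ
    obtain ⟨f, hf, z, hz⟩ := surj h h' _ hδ
    refine ⟨(f, g, -z), (pullbackD_eq_iff Φ q h' _ _).2 ⟨hf, hg, ?_⟩, 0, ?_⟩
    · change actComp Φ q (add_zero _) f - precompQ k q (zero_add _) g -
        δ (r - 1 - 1) (r - 1) (-z) = 0
      rw [hz, δ_neg]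
      abel
    · rw [map_zero, add_zero]
      rfl

end HomotopyPullback

end

section

open CochainComplex HomComplex

/-! ### Postcomposition: the action of `Hom(X, -)` on cochains of any degree. -/

section HomFunctor

variable {𝓖 : Type u} [Category.{v} 𝓖] [Abelian 𝓖] (X : CochainComplex 𝓖 ℤ)
  {A : Type w} [Ring A] (ρ : A →+* End X)

/-- The cochain from `Hom(X, Y)` to `Hom(X, Y')` given by postcomposition with a cochain from `Y`
to `Y'`. -/
def postcompCochain {Y Y' : CochainComplex 𝓖 ℤ} {n : ℤ} (c : Cochain Y Y' n) :
    Cochain (homComplexObj X ρ Y) (homComplexObj X ρ Y') n :=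
  Cochain.mk fun p r h => homModuleComp X ρ c p r h

/-- The morphism from `Hom(X, Y)` to `Hom(X, Y')` induced by a morphism from `Y` to `Y'`. -/
def homComplexMap {Y Y' : CochainComplex 𝓖 ℤ} (f : Y ⟶ Y') :
    homComplexObj X ρ Y ⟶ homComplexObj X ρ Y' :=
  (homComplexFunctor X ρ).map f

lemma homComplexMap_id (Y : CochainComplex 𝓖 ℤ) : homComplexMap X ρ (𝟙 Y) = 𝟙 _ :=
  (homComplexFunctor X ρ).map_id Y

lemma homComplexMap_zero (K L : CochainComplex 𝓖 ℤ) : homComplexMap X ρ (0 : K ⟶ L) = 0 := by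
  ext1 n
  exact homModule_hom_ext X ρ fun z =>
    (congrArg (fun c => z.comp c (add_zero n)) (Cochain.ofHom_zero K L)).trans
      (Cochain.comp_zero _ _)

lemma homComplexMap_comp {K L M : CochainComplex 𝓖 ℤ} (a : K ⟶ L) (b : L ⟶ M) :
    homComplexMap X ρ (a ≫ b) = homComplexMap X ρ a ≫ homComplexMap X ρ b :=
  (homComplexFunctor X ρ).map_comp a b

lemma postcompCochain_ofHom {Y Y' : CochainComplex 𝓖 ℤ} (f : Y ⟶ Y') :
    postcompCochain X ρ (Cochain.ofHom f) = Cochain.ofHom (homComplexMap X ρ f) := by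
  ext p : 1
  exact (Cochain.ofHom_v (homComplexMap X ρ f) p).symm

lemma postcompCochain_comp {Y Y' Y'' : CochainComplex 𝓖 ℤ} {n m r : ℤ} (c : Cochain Y Y' n)
    (c' : Cochain Y' Y'' m) (h : n + m = r) :
    postcompCochain X ρ (c.comp c' h) =
      (postcompCochain X ρ c).comp (postcompCochain X ρ c') h := by
  ext p l hpl : 1
  rw [Cochain.comp_v _ _ h p _ l rfl (by lia)]
  exact homModule_hom_ext X ρ fun z =>
    (Cochain.comp_assoc z c c' rfl h (show p + n + m = l by lia)).symm

/-- In the Leibniz rule for `z.comp c`, the sign sits on the term containing `δ z`. This term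
cancels against the second term of the differential of a cochain, so postcomposition commutes with
`δ` without any sign. -/
lemma δ_postcompCochain {Y Y' : CochainComplex 𝓖 ℤ} (n m : ℤ) (c : Cochain Y Y' n) :
    δ n m (postcompCochain X ρ c) = postcompCochain X ρ (δ n m c) := by
  by_cases h : n + 1 = m
  · ext p l hpl : 1
    rw [δ_v n m h _ p l hpl (l - 1) (p + 1) rfl rfl]
    refine homModule_hom_ext X ρ fun z => ?_
    change δ (l - 1) l (z.comp c (show p + n = l - 1 by lia)) +
      m.negOnePow • (δ p (p + 1) z).comp c (show p + 1 + n = l by lia) = z.comp (δ n m c) hpl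
    rw [δ_comp z c _ (p + 1) m l (by lia) rfl h,
      show m.negOnePow = -n.negOnePow by rw [← h, Int.negOnePow_succ], Units.neg_smul, add_assoc,
      add_neg_cancel, add_zero]
  · rw [δ_shape n m h, δ_shape n m h]
    ext p l hpl : 1
    exact homModule_hom_ext X ρ fun z => (Cochain.comp_zero z hpl).symm

end HomFunctor

/-! ### `Hom(X, -)` as a `k`-linear dg functor. -/

section Linear

variable (k : Type t) [CommRing k] {𝓖 : Type u} [Category.{v} 𝓖] [Abelian 𝓖] [Linear k 𝓖]
  (X : CochainComplex 𝓖 ℤ) {A : Type w} [Ring A] [Algebra k A] (ρ : A →ₐ[k] End X) {ι : Type s}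

open scoped ModuleCat.Algebra

lemma postcompCochain_add {Y Y' : CochainComplex 𝓖 ℤ} {n : ℤ} (c c' : Cochain Y Y' n) :
    postcompCochain X ρ.toRingHom (c + c') =
      postcompCochain X ρ.toRingHom c + postcompCochain X ρ.toRingHom c' := by
  ext p r h : 1
  exact homModule_hom_ext X ρ.toRingHom fun z => Cochain.comp_add z c c' h

/-- On the module side, `k` acts through `A`, that is, by precomposition with `ρ (algebraMap k A
a)`. As `ρ` is a morphism of `k`-algebras this is `a • 𝟙 X`, and the two scalar actions agree. -/
lemma postcompCochain_smul {Y Y' : CochainComplex 𝓖 ℤ} {n : ℤ} (a : k) (c : Cochain Y Y' n) :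
    postcompCochain X ρ.toRingHom (a • c) = a • postcompCochain X ρ.toRingHom c := by
  ext p r h : 1
  refine homModule_hom_ext X ρ.toRingHom fun z => ?_
  change z.comp (a • c) h = (Cochain.ofHom (ρ (algebraMap k A a))).comp (z.comp c h) (zero_add r)
  rw [AlgHom.commutes, Algebra.algebraMap_eq_smul_one]
  have : Cochain.ofHom (a • 𝟙 X) = a • Cochain.ofHom (𝟙 X) := by
    ext
    simp
  change z.comp (a • c) h = (Cochain.ofHom (a • 𝟙 X)).comp (z.comp c h) (zero_add r)
  rw [this, Cochain.smul_comp, Cochain.id_comp, Cochain.comp_smul]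

/-- The differential graded functor `Hom(X, -)`. -/
def homComplexDG (Y : ι → CochainComplex 𝓖 ℤ) :
    DGMap (homDG k Y) (homDG k fun i => homComplexObj X ρ.toRingHom (Y i)) where
  map {i j n} :=
    { toFun := fun c : Cochain (Y i) (Y j) n => postcompCochain X ρ.toRingHom c
      map_add' := postcompCochain_add k X ρ
      map_smul' := postcompCochain_smul k X ρ }
  map_d {i j n m} _ x := (δ_postcompCochain X ρ.toRingHom n m x).symm
  map_id i := by
    refine (postcompCochain_ofHom X ρ.toRingHom (𝟙 (Y i))).trans ?_
    rw [homComplexMap_id]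
    rfl
  map_comp h x y := postcompCochain_comp X ρ.toRingHom x y h

end Linear

end

section

open CochainComplex HomComplex

/-! ### Compatibility of `Hom(X, -)` with shifts. -/

section Shift

variable {𝓖 : Type u} [Category.{v} 𝓖] [Abelian 𝓖] (X : CochainComplex 𝓖 ℤ)
  {A : Type w} [Ring A] (ρ : A →+* End X)

/-- The closed cochain from `Hom(X, Y)` to `Hom(X, Y')` given by postcomposition with a closed
cochain from `Y` to `Y'`. -/
def postcompCocycle {Y Y' : CochainComplex 𝓖 ℤ} {n : ℤ} (c : Cocycle Y Y' n) :
    Cocycle (homComplexObj X ρ Y) (homComplexObj X ρ Y') n :=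
  Cocycle.mk (postcompCochain X ρ c.1) _ rfl (by
    rw [δ_postcompCochain, Cocycle.δ_eq_zero]
    ext p l hpl : 1
    exact homModule_hom_ext X ρ fun z => Cochain.comp_zero z hpl)

lemma rightUnshift_id_comp_rightShift_id (Y : CochainComplex 𝓖 ℤ) (n : ℤ) :
    ((Cochain.ofHom (𝟙 (Y⟦n⟧))).rightUnshift n (zero_add n)).comp
      ((Cochain.ofHom (𝟙 Y)).rightShift n (-n) (neg_add_cancel n)) (add_neg_cancel n) =
      Cochain.ofHom (𝟙 (Y⟦n⟧)) := by
  apply (Cochain.rightShiftAddEquiv _ _ n n 0 (zero_add n)).symm.injective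
  change Cochain.rightUnshift _ n (zero_add n) = Cochain.rightUnshift _ n (zero_add n)
  rw [Cochain.rightUnshift_comp _ _ _ _ _ 0 (neg_add_cancel n), Cochain.rightUnshift_rightShift,
    Cochain.comp_id]

lemma rightShift_id_comp_rightUnshift_id (Y : CochainComplex 𝓖 ℤ) (n : ℤ) :
    ((Cochain.ofHom (𝟙 Y)).rightShift n (-n) (neg_add_cancel n)).comp
      ((Cochain.ofHom (𝟙 (Y⟦n⟧))).rightUnshift n (zero_add n)) (neg_add_cancel n) =
      Cochain.ofHom (𝟙 Y) := by
  rw [← Cochain.rightUnshift_comp _ _ (add_zero (-n)) _ (neg_add_cancel n), Cochain.comp_id,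
    Cochain.rightUnshift_rightShift]

/-- The comparison morphism from `Hom(X, Y⟦n⟧)` to `Hom(X, Y)⟦n⟧`. -/
def homComplexShift (Y : CochainComplex 𝓖 ℤ) (n : ℤ) :
    homComplexObj X ρ (Y⟦n⟧) ⟶ (homComplexObj X ρ Y)⟦n⟧ :=
  Cocycle.equivHomShift.symm (postcompCocycle X ρ (Cocycle.equivHomShift (𝟙 (Y⟦n⟧))))

lemma homModuleComp_comp {Y Y' Y'' : CochainComplex 𝓖 ℤ} {m m' m'' : ℤ} (c : Cochain Y Y' m)
    (c' : Cochain Y' Y'' m') (h : m + m' = m'') (p q r : ℤ) (h₁ : p + m = q) (h₂ : q + m' = r) :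
    homModuleComp X ρ c p q h₁ ≫ homModuleComp X ρ c' q r h₂ =
      homModuleComp X ρ (c.comp c' h) p r (by lia) :=
  homModule_hom_ext X ρ fun z => Cochain.comp_assoc z c c' h₁ h (by lia)

lemma homModuleComp_id (Y : CochainComplex 𝓖 ℤ) (p : ℤ) :
    homModuleComp X ρ (Cochain.ofHom (𝟙 Y)) p p (add_zero p) = 𝟙 (homModule X ρ Y p) :=
  homModule_hom_ext X ρ fun z => Cochain.comp_id z

/-- The tautological cochain of degree `n` from `Y⟦n⟧` to `Y` has a two-sided inverse of degree
`-n`, so postcomposition with it is bijective in each degree. -/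
instance isIso_homComplexShift (Y : CochainComplex 𝓖 ℤ) (n : ℤ) :
    IsIso (homComplexShift X ρ Y n) := by
  have (p : ℤ) : IsIso ((homComplexShift X ρ Y n).f p) := by
    let e : homModule X ρ (Y⟦n⟧) p ≅ homModule X ρ Y (p + n) :=
      { hom := homModuleComp X ρ ((Cochain.ofHom (𝟙 (Y⟦n⟧))).rightUnshift n (zero_add n)) _ _ rfl
        inv := homModuleComp X ρ ((Cochain.ofHom (𝟙 Y)).rightShift n (-n) (neg_add_cancel n)) _ _
          (by lia)
        hom_inv_id := by
          rw [homModuleComp_comp _ _ _ _ (add_neg_cancel n), rightUnshift_id_comp_rightShift_id,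
            homModuleComp_id]
        inv_hom_id := by
          rw [homModuleComp_comp _ _ _ _ (neg_add_cancel n), rightShift_id_comp_rightUnshift_id,
            homModuleComp_id] }
    have : (homComplexShift X ρ Y n).f p =
        e.hom ≫ ((homComplexObj X ρ Y).shiftFunctorObjXIso n p (p + n) rfl).inv := by
      exact Cochain.rightShift_v _ n 0 (zero_add n) p p (add_zero p) (p + n) rfl
    rw [this]
    exact IsIso.comp_isIso' e.isIso_hom (Iso.isIso_inv _)
  exact HomologicalComplex.Hom.isIso_of_components _

/-- Every cocycle of degree `n` is obtained from the tautological one on `Y'⟦n⟧` by precomposition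
with a chain map, so only that universal case matters. The formula turns questions on cohomology in
degree `n` into questions on morphisms to a shift. -/
lemma equivHomShift_symm_postcompCocycle {Y Y' : CochainComplex 𝓖 ℤ} {n : ℤ}
    (c : Cocycle Y Y' n) :
    Cocycle.equivHomShift.symm (postcompCocycle X ρ c) =
      homComplexMap X ρ (Cocycle.equivHomShift.symm c) ≫ homComplexShift X ρ Y' n := by
  have h₁ : c = (Cocycle.equivHomShift (𝟙 (Y'⟦n⟧))).precomp (Cocycle.equivHomShift.symm c) := by
    rw [← Cocycle.equivHomShift_comp, Category.comp_id, AddEquiv.apply_symm_apply]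
  have h₂ : postcompCocycle X ρ c =
      (postcompCocycle X ρ (Cocycle.equivHomShift (𝟙 (Y'⟦n⟧)))).precomp
        (homComplexMap X ρ (Cocycle.equivHomShift.symm c)) := by
    apply Cocycle.ext
    refine (congrArg (fun c : Cocycle Y Y' n => postcompCochain X ρ c.1) h₁).trans ?_
    refine (postcompCochain_comp X ρ _ _ (zero_add n)).trans ?_
    rw [postcompCochain_ofHom]
    rfl
  rw [h₂, Cocycle.equivHomShift_symm_precomp]
  rfl

end Shift

/-! ### Cohomology of Hom complexes and morphisms in the derived category. -/

section Derived

variable {𝓖 : Type u} [Category.{v} 𝓖] [Abelian 𝓖] [HasDerivedCategory.{w} 𝓖]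

open DerivedCategory

lemma quotient_map_eq_zero_of_Q_map_eq_zero {K L : CochainComplex 𝓖 ℤ} [L.IsKInjective]
    (f : K ⟶ L) (hf : Q.map f = 0) : (HomotopyCategory.quotient 𝓖 (.up ℤ)).map f = 0 := by
  apply (CochainComplex.IsKInjective.Qh_map_bijective _ L).injective
  rw [Functor.map_zero]
  exact hf

lemma exists_Q_map_eq {K L : CochainComplex 𝓖 ℤ} [L.IsKInjective] (φ : Q.obj K ⟶ Q.obj L) :
    ∃ f : K ⟶ L, Q.map f = φ := by
  obtain ⟨g, hg⟩ := (CochainComplex.IsKInjective.Qh_map_bijective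
    ((HomotopyCategory.quotient _ _).obj K) L).surjective φ
  obtain ⟨f, rfl⟩ := (HomotopyCategory.quotient _ _).map_surjective g
  exact ⟨f, hg⟩

lemma Q_map_equivHomShift_symm_eq_zero {K L : CochainComplex 𝓖 ℤ} {n : ℤ} (z : Cocycle K L n)
    (m : ℤ) (h : m + 1 = n) (hz : ∃ y, δ m n y = z.1) :
    Q.map (Cocycle.equivHomShift.symm z) = 0 := by
  have := (CohomologyClass.toHom_mk_eq_zero_iff z).2 ((mem_coboundaries_iff _ m h).2 hz)
  rw [CohomologyClass.toHom_mk] at this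
  exact (congrArg Qh.map this).trans (Functor.map_zero _ _ _)

/-- The shift `L⟦n⟧` is K-injective too, so vanishing in the derived category is already vanishing
up to homotopy, and a null-homotopy is a primitive of `z`. -/
lemma exists_δ_eq {K L : CochainComplex 𝓖 ℤ} [L.IsKInjective] {n : ℤ} (z : Cocycle K L n)
    (m : ℤ) (h : m + 1 = n) (hz : Q.map (Cocycle.equivHomShift.symm z) = 0) :
    ∃ y, δ m n y = z.1 := by
  refine (mem_coboundaries_iff _ m h).1 ((CohomologyClass.toHom_mk_eq_zero_iff z).1 ?_)
  rw [CohomologyClass.toHom_mk]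
  exact quotient_map_eq_zero_of_Q_map_eq_zero _ hz

/-- Together with `exists_eq_precomp_add_δ`, this says that precomposition with a quasi-isomorphism
is bijective on cohomology when the target is K-injective; it handles the right leg of the cospan.
-/
lemma exists_precomp_δ_eq {K K' L : CochainComplex 𝓖 ℤ} [L.IsKInjective] (q : K ⟶ K')
    [IsIso (Q.map q)] {n m r : ℤ} (h : n + 1 = m) (h' : m + 1 = r) (g : Cochain K' L m)
    (hg : δ m r g = 0) (hz : ∃ z, δ n m z = (Cochain.ofHom q).comp g (zero_add m)) :
    ∃ g', δ n m g' = g := by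
  let c := Cocycle.mk g r h' hg
  have := Q_map_equivHomShift_symm_eq_zero (c.precomp q) n h hz
  rw [Cocycle.equivHomShift_symm_precomp, Functor.map_comp] at this
  exact exists_δ_eq c n h ((cancel_epi (Q.map q)).1 (this.trans comp_zero.symm))

lemma exists_eq_precomp_add_δ {K K' L : CochainComplex 𝓖 ℤ} [L.IsKInjective] (q : K ⟶ K')
    [IsIso (Q.map q)] {n m r : ℤ} (h : n + 1 = m) (h' : m + 1 = r) (y : Cochain K L m)
    (hy : δ m r y = 0) :
    ∃ g : Cochain K' L m, δ m r g = 0 ∧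
      ∃ z, y = (Cochain.ofHom q).comp g (zero_add m) + δ n m z := by
  let c := Cocycle.mk y r h' hy
  obtain ⟨f, hf⟩ := exists_Q_map_eq (inv (Q.map q) ≫ Q.map (Cocycle.equivHomShift.symm c))
  obtain ⟨z, hz⟩ := exists_δ_eq (c - (Cocycle.equivHomShift f).precomp q) n h (by
    rw [map_sub, Cocycle.equivHomShift_symm_precomp, AddEquiv.symm_apply_apply, Functor.map_sub,
      Functor.map_comp, hf, IsIso.hom_inv_id_assoc, sub_self])
  refine ⟨(Cocycle.equivHomShift f).1, Cocycle.δ_eq_zero _ _, z, ?_⟩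
  rw [hz]
  exact (add_sub_cancel _ _).symm

end Derived

end

section

/-! ### Epimorphisms from ind-objects onto objects of `D`. -/

section Domination

variable {D : Type u} [SmallCategory D]

lemma ind_yoneda_hom_ext {c : D} {Y : Ind D} {f g : Ind.yoneda.obj c ⟶ Y}
    (h : ((Ind.inclusion D).map f).app (.op c)
        ((Ind.yonedaCompInclusion.inv.app c).app (.op c) (𝟙 c)) =
      ((Ind.inclusion D).map g).app (.op c)
        ((Ind.yonedaCompInclusion.inv.app c).app (.op c) (𝟙 c))) : f = g := by
  apply (Ind.inclusion D).map_injective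
  rw [← cancel_epi (Ind.yonedaCompInclusion.inv.app c)]
  apply yonedaEquiv.injective
  exact h

/-- The representable ind-objects are finitely presented: two morphisms to a term of a filtered
diagram which are equal in the colimit are equal at some stage. -/
lemma exists_comp_map_eq_of_comp_ι_eq {I : Type u} [SmallCategory I] [IsFiltered I] (G : I ⥤ D)
    {c : D} {i : I} (f g : c ⟶ G.obj i)
    (h : Ind.yoneda.map f ≫ colimit.ι (G ⋙ Ind.yoneda) i =
      Ind.yoneda.map g ≫ colimit.ι (G ⋙ Ind.yoneda) i) :
    ∃ (j : I) (a : i ⟶ j), f ≫ G.map a = g ≫ G.map a := by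
  let hc := isColimitOfPreserves ((evaluation _ _).obj (.op c))
    (isColimitOfPreserves (Ind.inclusion D) (colimit.isColimit (G ⋙ Ind.yoneda)))
  have hx := congrArg (fun φ => ((Ind.inclusion D).map φ).app (.op c)
    ((Ind.yonedaCompInclusion.inv.app c).app (.op c) (𝟙 c))) h
  simp only [Functor.map_comp] at hx
  obtain ⟨j, a, ha⟩ := (Types.FilteredColimit.isColimit_eq_iff' hc _ _).1 hx
  refine ⟨j, a, Ind.yoneda.map_injective (ind_yoneda_hom_ext ?_)⟩
  rw [Functor.map_comp, Functor.map_comp, Functor.map_comp, Functor.map_comp]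
  exact ha

/-- An epimorphism from an ind-object to an object of `D` is dominated by an epimorphism
in `D`. -/
lemma exists_epi_yoneda_comp [Abelian D] {c : D} {Z : Ind D} (p : Z ⟶ Ind.yoneda.obj c) [Epi p] :
    ∃ (d : D) (f : d ⟶ c) (a : Ind.yoneda.obj d ⟶ Z), Epi f ∧ a ≫ p = Ind.yoneda.map f := by
  let F := Z.presentation.F
  let leg (i) : Ind.yoneda.obj (F.obj i) ⟶ Z :=
    colimit.ι (F ⋙ Ind.yoneda) i ≫ Z.colimitPresentationCompYoneda.hom
  have hleg {i j} (a : i ⟶ j) : Ind.yoneda.map (F.map a) ≫ leg j = leg i :=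
    colimit.w_assoc (F ⋙ Ind.yoneda) a _
  -- Writing `Z` as a filtered colimit of the `F i`, the morphism `p` becomes a cocone `ψ`. Its
  -- termwise cokernels form a filtered diagram, and it suffices that one of them vanishes.
  let ψ : F ⟶ (Functor.const _).obj c :=
    { app i := Ind.yoneda.preimage (leg i ≫ p)
      naturality i j a := Ind.yoneda.map_injective (by
        simp [reassoc_of% hleg a]) }
  have hψ (i) : Ind.yoneda.map (ψ.app i) = leg i ≫ p := Functor.map_preimage _ _
  let t (i) : Ind.yoneda.obj c ⟶ colimit (cokernel ψ ⋙ Ind.yoneda) :=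
    Ind.yoneda.map ((cokernel.π ψ).app i) ≫ colimit.ι (cokernel ψ ⋙ Ind.yoneda) i
  have ht' {i j} (a : i ⟶ j) : t i = t j := by
    have := (cokernel.π ψ).naturality a
    dsimp at this
    rw [Category.id_comp] at this
    simp only [t]
    rw [this, Functor.map_comp, Category.assoc]
    congr 1
    exact (colimit.w (cokernel ψ ⋙ Ind.yoneda) a).symm
  have ht (i j) : t i = t j :=
    (ht' (IsFiltered.leftToMax i j)).trans (ht' (IsFiltered.rightToMax i j)).symm
  let i₀ : Z.presentation.I := IsFiltered.nonempty.some
  -- `t` is the map from `c` to the colimit of the cokernels. It is independent of the index and is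
  -- killed by `p`, hence zero because `p` is an epimorphism.
  have h₀ : t i₀ = 0 := by
    rw [← cancel_epi p, comp_zero, ← cancel_epi Z.colimitPresentationCompYoneda.hom, comp_zero]
    refine colimit.hom_ext fun i => ?_
    have h : ψ.app i ≫ (cokernel.π ψ).app i = 0 := by
      rw [← NatTrans.comp_app, cokernel.condition]
      rfl
    rw [ht i₀ i, comp_zero]
    change _ ≫ _ ≫ p ≫ Ind.yoneda.map _ ≫ _ = _
    have h' := congrArg Ind.yoneda.map h
    rw [Functor.map_comp, hψ, Functor.map_zero] at h'
    have h'' := congrArg (· ≫ colimit.ι (cokernel ψ ⋙ Ind.yoneda) i) h'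
    simpa only [Category.assoc, zero_comp, leg] using h''
  -- As `c` is finitely presented, this vanishing occurs at a finite stage `j`; there the projection
  -- to the cokernel is zero and `ψ.app j` is an epimorphism.
  obtain ⟨j, a, ha⟩ := exists_comp_map_eq_of_comp_ι_eq (cokernel ψ) ((cokernel.π ψ).app i₀) 0 (by
    rw [Functor.map_zero, zero_comp]
    exact h₀)
  have hj : (cokernel.π ψ).app j = 0 := by
    have := (cokernel.π ψ).naturality a
    dsimp at this
    rw [Category.id_comp] at this
    rw [this, ha, zero_comp]
  have : Epi (ψ.app j) := ((ShortComplex.exact_cokernel ψ).map ((evaluation _ _).obj j)).epi_f hj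
  exact ⟨F.obj j, ψ.app j, leg j, this, (hψ j).symm⟩

end Domination

end

section

/-! ### Effaceability and surjectivity on `Ext` groups. -/

section Ext

open Abelian Ext

/-- If there are enough injectives, classes of positive degree are killed by epimorphisms. -/
lemma exists_epi_comp_eq_zero {𝓖 : Type u} [Category.{v} 𝓖] [Abelian 𝓖] [HasExt.{w} 𝓖]
    [EnoughInjectives 𝓖] {n : ℕ} {A B : 𝓖} (x : Ext A B (n + 1)) :
    ∃ (Z : 𝓖) (p : Z ⟶ A), Epi p ∧ (mk₀ p).comp x (zero_add _) = 0 := by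
  induction n generalizing A B with
  | zero =>
    let S := ShortComplex.mk _ _ (cokernel.condition (Injective.ι B))
    have hS : S.ShortExact := { exact := ShortComplex.exact_cokernel (Injective.ι B) }
    obtain ⟨y, rfl⟩ := covariant_sequence_exact₁ _ hS x (eq_zero_of_injective _) (zero_add _)
    obtain ⟨g, rfl⟩ := (mk₀_bijective _ _).2 y
    have : Epi S.g := hS.epi_g
    -- In degree one, `x` is the pullback along `g` of the extension `S`. Over the fibre product `g`
    -- lifts through `S.g`, so the extension splits.
    refine ⟨pullback g S.g, pullback.fst g S.g, inferInstance, ?_⟩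
    rw [mk₀_comp_mk₀_assoc, pullback.condition, ← mk₀_comp_mk₀_assoc, hS.comp_extClass,
      Ext.comp_zero]
  | succ n hn =>
    let S := ShortComplex.mk _ _ (cokernel.condition (Injective.ι B))
    have hS : S.ShortExact := { exact := ShortComplex.exact_cokernel (Injective.ι B) }
    obtain ⟨y, rfl⟩ := covariant_sequence_exact₁ _ hS x (eq_zero_of_injective _) rfl
    obtain ⟨Z, p, hp, h⟩ := hn y
    refine ⟨Z, p, hp, ?_⟩
    rw [← Ext.comp_assoc _ _ _ (zero_add _) _ (by lia), h, Ext.zero_comp]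

end Ext

section ExactFunctor

open Abelian

variable {C : Type u} [Category.{v} C] [Abelian C] {𝓖 : Type w} [Category.{w'} 𝓖] [Abelian 𝓖]
  (F : C ⥤ 𝓖) [F.Additive] [PreservesFiniteLimits F] [PreservesFiniteColimits F]

/-- If epimorphisms to objects in the image of `F` are dominated by epimorphisms in the source of
`F`, then `F` induces surjective maps on `Ext` groups. -/
lemma mapExactFunctor_surjective [F.Full] [EnoughInjectives 𝓖] [HasExt.{s} C] [HasExt.{t} 𝓖]
    (hF : ∀ (c : C) (Z : 𝓖) (p : Z ⟶ F.obj c) [Epi p],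
      ∃ (d : C) (f : d ⟶ c) (a : F.obj d ⟶ Z), Epi f ∧ a ≫ p = F.map f)
    (A B : C) (n : ℕ) : Function.Surjective (Ext.mapExactFunctor F (X := A) (Y := B) (n := n)) := by
  induction n generalizing A with
  | zero =>
    rw [Ext.mapExactFunctor₀]
    exact Ext.homEquiv₀.symm.surjective.comp (F.map_surjective.comp Ext.homEquiv₀.surjective)
  | succ n hn =>
    intro x
    obtain ⟨Z, p, _, hp⟩ := exists_epi_comp_eq_zero x
    obtain ⟨d, f, a, _, ha⟩ := hF A Z p
    let S := ShortComplex.mk _ _ (kernel.condition f)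
    have hS : S.ShortExact := { exact := ShortComplex.exact_kernel f }
    obtain ⟨y, rfl⟩ := Ext.contravariant_sequence_exact₃ (hS.map_of_exact F) _ x (by
      change (Ext.mk₀ (F.map f)).comp x _ = 0
      -- Domination lets `F.map f` kill `x`, so `x` comes from degree `n` on the image of `kernel
      -- f`, an object of `C` to which induction applies.
      rw [← ha, ← Ext.mk₀_comp_mk₀_assoc, hp, Ext.comp_zero]) (add_comm 1 n)
    obtain ⟨y, rfl⟩ := hn _ y
    exact ⟨hS.extClass.comp y (add_comm 1 n), by
      rw [Ext.mapExactFunctor_comp, Ext.mapExactFunctor_extClass]; rfl⟩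

end ExactFunctor

/-! ### Four lemmas for triangulated functors. -/

section Surjective

variable {𝓒 : Type u} [Category.{v} 𝓒] {𝓓 : Type w} [Category.{w'} 𝓓] {G : 𝓒 ⥤ 𝓓}

lemma map_surjective_of_iso {X X' Y Y' : 𝓒} (e : X ≅ X') (e' : Y ≅ Y')
    (h : Function.Surjective (G.map : (X ⟶ Y) → _)) :
    Function.Surjective (G.map : (X' ⟶ Y') → _) := fun φ => by
  obtain ⟨f, hf⟩ := h (G.map e.hom ≫ φ ≫ G.map e'.inv)
  refine ⟨e.inv ≫ f ≫ e'.hom, ?_⟩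
  rw [Functor.map_comp, Functor.map_comp, hf]
  simp [← Functor.map_comp, ← Functor.map_comp_assoc]

lemma map_surjective_shift [HasShift 𝓒 ℤ] [HasShift 𝓓 ℤ] [G.CommShift ℤ] {X Y : 𝓒}
    (h : Function.Surjective (G.map : (X ⟶ Y) → _)) (n : ℤ) :
    Function.Surjective (G.map : (X⟦n⟧ ⟶ Y⟦n⟧) → _) := fun φ => by
  obtain ⟨ψ, hψ⟩ := (CategoryTheory.shiftFunctor 𝓓 n).map_surjective
    ((G.commShiftIso n).inv.app X ≫ φ ≫ (G.commShiftIso n).hom.app Y)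
  obtain ⟨f, rfl⟩ := h ψ
  refine ⟨f⟦n⟧', ?_⟩
  rw [← cancel_mono ((G.commShiftIso n).hom.app Y), ← cancel_epi ((G.commShiftIso n).inv.app X),
    ← hψ]
  simp

variable [Preadditive 𝓒] [Preadditive 𝓓] [HasZeroObject 𝓒] [HasZeroObject 𝓓]
  [HasShift 𝓒 ℤ] [HasShift 𝓓 ℤ] [∀ n : ℤ, (CategoryTheory.shiftFunctor 𝓒 n).Additive]
  [∀ n : ℤ, (CategoryTheory.shiftFunctor 𝓓 n).Additive] [Pretriangulated 𝓒] [Pretriangulated 𝓓]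
  [G.CommShift ℤ] [G.IsTriangulated] {T : Pretriangulated.Triangle 𝓒}

open Pretriangulated

/-- A four lemma: after lifting the restriction of `φ` to `T.obj₁`, the obstruction to extending the
lift over `T.obj₂` lives on `T.obj₃⟦-1⟧` and vanishes by injectivity. The remaining difference
factors through `T.obj₃`. -/
lemma map_surjective_obj₂_left (hT : T ∈ distTriang 𝓒) {Y : 𝓒}
    (h₁ : Function.Surjective (G.map : (T.obj₁ ⟶ Y) → _))
    (h₃ : Function.Surjective (G.map : (T.obj₃ ⟶ Y) → _))
    (h : Function.Injective (G.map : (T.obj₃⟦(-1 : ℤ)⟧ ⟶ Y) → _)) :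
    Function.Surjective (G.map : (T.obj₂ ⟶ Y) → _) := fun φ => by
  obtain ⟨a, ha⟩ := h₁ (G.map T.mor₁ ≫ φ)
  have hT' := inv_rot_of_distTriang _ hT
  let v : T.obj₃⟦(-1 : ℤ)⟧ ⟶ T.obj₁ := T.invRotate.mor₁
  have hv : v ≫ T.mor₁ = 0 := comp_distTriang_mor_zero₁₂ _ hT'
  have hva : v ≫ a = 0 := h (by
    rw [Functor.map_comp, ha, ← Functor.map_comp_assoc, hv, Functor.map_zero, Functor.map_zero,
      zero_comp])
  obtain ⟨b, hb⟩ : ∃ b : T.obj₂ ⟶ Y, a = T.mor₁ ≫ b := Triangle.yoneda_exact₂ _ hT' a hva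
  obtain ⟨c, hc⟩ : ∃ c : G.obj T.obj₃ ⟶ G.obj Y, φ - G.map b = G.map T.mor₂ ≫ c :=
    Triangle.yoneda_exact₂ _ (G.map_distinguished T hT) (φ - G.map b) (by
      change G.map T.mor₁ ≫ (φ - G.map b) = 0
      rw [Preadditive.comp_sub, ← ha, hb, Functor.map_comp, sub_self])
  obtain ⟨c, rfl⟩ := h₃ c
  exact ⟨T.mor₂ ≫ c + b, by rw [Functor.map_add, Functor.map_comp, ← hc, sub_add_cancel]⟩

lemma map_surjective_obj₂_right (hT : T ∈ distTriang 𝓒) {X : 𝓒}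
    (h₁ : Function.Surjective (G.map : (X ⟶ T.obj₁) → _))
    (h₃ : Function.Surjective (G.map : (X ⟶ T.obj₃) → _))
    (h : Function.Injective (G.map : (X ⟶ T.obj₁⟦(1 : ℤ)⟧) → _)) :
    Function.Surjective (G.map : (X ⟶ T.obj₂) → _) := fun φ => by
  obtain ⟨a, ha⟩ := h₃ (φ ≫ G.map T.mor₂)
  obtain ⟨b, hb⟩ := Triangle.coyoneda_exact₃ _ hT a (h (by
    rw [Functor.map_comp, ha, Category.assoc, ← Functor.map_comp, comp_distTriang_mor_zero₂₃ _ hT,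
      Functor.map_zero, Functor.map_zero, comp_zero]))
  obtain ⟨c, hc⟩ : ∃ c : G.obj X ⟶ G.obj T.obj₁, φ - G.map b = c ≫ G.map T.mor₁ :=
    Triangle.coyoneda_exact₂ _ (G.map_distinguished T hT) (φ - G.map b) (by
      change (φ - G.map b) ≫ G.map T.mor₂ = 0
      rw [Preadditive.sub_comp, ← ha, hb, Functor.map_comp, sub_self])
  obtain ⟨c, rfl⟩ := h₁ c
  exact ⟨c ≫ T.mor₁ + b, by rw [Functor.map_add, Functor.map_comp, ← hc, sub_add_cancel]⟩

end Surjective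

/-! ### Fullness on bounded derived categories by dévissage. -/

section Derived

open DerivedCategory

variable {C : Type u} [Category.{v} C] [Abelian C] [HasDerivedCategory.{s} C]

/-- The bounded derived category is generated by complexes concentrated in one degree. -/
lemma bounded_le (P : ObjectProperty (DerivedCategory C)) [P.IsClosedUnderIsomorphisms]
    (h : ∀ (A : C) (n : ℤ), P ((singleFunctor C n).obj A))
    (h' : ∀ T ∈ distTriang (DerivedCategory C), TStructure.t.bounded T.obj₁ →
      TStructure.t.bounded T.obj₃ → P T.obj₁ → P T.obj₃ → P T.obj₂) :
    TStructure.t.bounded ≤ P := by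
  have key (n : ℕ) : ∀ (E : DerivedCategory C) (a b : ℤ), b = a + n → E.IsGE a → E.IsLE b →
      P E := by
    induction n with
    | zero =>
      rintro E a b rfl _ hb
      have : E.IsLE a := by simpa using hb
      obtain ⟨A, ⟨e⟩⟩ := E.exists_iso_singleFunctor_obj_of_isGE_of_isLE a
      exact P.prop_of_iso e.symm (h A a)
    | succ n hn =>
      rintro E a b hab _ _
      have hE := TStructure.t.triangleLEGE_distinguished a (a + 1) rfl E
      have h₁ : ((TStructure.t.truncLE a).obj E).IsGE a := inferInstance
      have h₁' : ((TStructure.t.truncLE a).obj E).IsLE a := inferInstance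
      have h₁'' : ((TStructure.t.truncLE a).obj E).IsLE (a + n) :=
        TStructure.t.isLE_of_le _ a _
      have h₃ : ((TStructure.t.truncGE (a + 1)).obj E).IsLE b := inferInstance
      have h₃' : ((TStructure.t.truncGE (a + 1)).obj E).IsGE (a + 1) := inferInstance
      exact h' _ hE ⟨⟨a, h₁⟩, ⟨a, h₁'⟩⟩ ⟨⟨a + 1, h₃'⟩, ⟨b, h₃⟩⟩
        (hn _ a (a + n) rfl h₁ h₁'')
        (hn _ (a + 1) b (by push_cast at hab; lia) h₃' h₃)
  rintro E ⟨⟨a, ha⟩, ⟨b, hb⟩⟩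
  -- The upper bound is enlarged to `a + (b - a).toNat`, which also covers the case `b < a`.
  exact key (b - a).toNat E a (a + (b - a).toNat) rfl ha (TStructure.t.isLE_of_le _ b _)

variable {𝓖 : Type w} [Category.{w'} 𝓖] [Abelian 𝓖] [HasDerivedCategory.{t} 𝓖]
  (F : C ⥤ 𝓖) [F.Additive] [PreservesFiniteLimits F] [PreservesFiniteColimits F]

lemma mapDerivedCategory_surjective_single [F.Full] [EnoughInjectives 𝓖]
    (hF : ∀ (c : C) (Z : 𝓖) (p : Z ⟶ F.obj c) [Epi p],
      ∃ (d : C) (f : d ⟶ c) (a : F.obj d ⟶ Z), Epi f ∧ a ≫ p = F.map f) (A B : C) (n : ℤ) :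
    Function.Surjective (F.mapDerivedCategory.map :
      ((singleFunctor C 0).obj A ⟶ ((singleFunctor C 0).obj B)⟦n⟧) → _) := fun φ => by
  let φ' : ShiftedHom ((singleFunctor 𝓖 0).obj (F.obj A)) ((singleFunctor 𝓖 0).obj (F.obj B)) n :=
    (F.mapDerivedCategorySingleFunctor 0).inv.app A ≫ φ ≫
      (F.mapDerivedCategory.commShiftIso n).hom.app _ ≫
        ((F.mapDerivedCategorySingleFunctor 0).hom.app B)⟦n⟧'
  suffices ∃ f : ShiftedHom ((singleFunctor C 0).obj A) ((singleFunctor C 0).obj B) n,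
      φ' = (F.mapDerivedCategorySingleFunctor 0).inv.app A ≫ f.map F.mapDerivedCategory ≫
        ((F.mapDerivedCategorySingleFunctor 0).hom.app B)⟦n⟧' by
    obtain ⟨f, hf⟩ := this
    refine ⟨f, ?_⟩
    simp only [φ', cancel_epi, ShiftedHom.map, ← Category.assoc, cancel_mono] at hf
    exact hf.symm
  by_cases hn : 0 ≤ n
  · lift n to ℕ using hn
    have := hasExt_of_hasDerivedCategory C
    have := hasExt_of_hasDerivedCategory 𝓖
    obtain ⟨y, hy⟩ := mapExactFunctor_surjective F hF A B n (Abelian.Ext.homEquiv.symm φ')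
    refine ⟨y.hom, ?_⟩
    rw [← Abelian.Ext.mapExactFunctor_hom, hy]
    exact (Abelian.Ext.homEquiv.apply_symm_apply φ').symm
  -- In negative degree there are no nonzero morphisms in the target, by the t-structure.
  · have : TStructure.t.IsGE (((singleFunctor 𝓖 0).obj (F.obj B))⟦n⟧) (-n) :=
      TStructure.t.isGE_shift _ 0 _ _
    refine ⟨0, ?_⟩
    rw [TStructure.t.zero_of_isLE_of_isGE φ' 0 (-n) (by lia) inferInstance this]
    simp [ShiftedHom.map]

/-- If epimorphisms to objects in the image of `F` are dominated by epimorphisms in the source of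
the full exact functor `F`, and if the functor induced by `F` on bounded derived categories is
faithful, then it is full. -/
lemma mapDerivedCategory_surjective [F.Full] [EnoughInjectives 𝓖]
    (hF : ∀ (c : C) (Z : 𝓖) (p : Z ⟶ F.obj c) [Epi p],
      ∃ (d : C) (f : d ⟶ c) (a : F.obj d ⟶ Z), Epi f ∧ a ≫ p = F.map f)
    (inj : ∀ E E' : DerivedCategory C, TStructure.t.bounded E → TStructure.t.bounded E' →
      Function.Injective (F.mapDerivedCategory.map : (E ⟶ E') → _)) (E E' : DerivedCategory C)
    (hE : TStructure.t.bounded E) (hE' : TStructure.t.bounded E') :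
    Function.Surjective (F.mapDerivedCategory.map : (E ⟶ E') → _) := by
  have bdd (A : C) (n : ℤ) : TStructure.t.bounded ((singleFunctor C n).obj A) :=
    ⟨⟨n, inferInstance⟩, ⟨n, inferInstance⟩⟩
  -- Morphisms from `A[-n]` to `B[-m]` are the shift by `-n` of those from `A` to `B[n - m]`.
  have single (A B : C) (n m : ℤ) : Function.Surjective (F.mapDerivedCategory.map :
      ((singleFunctor C n).obj A ⟶ (singleFunctor C m).obj B) → _) := by
    refine map_surjective_of_iso (((singleFunctors C).shiftIso (-n) n 0 (by lia)).app A)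
      ?_ (map_surjective_shift
        (mapDerivedCategory_surjective_single F hF A B (n - m)) (-n))
    exact ((shiftFunctorAdd' (DerivedCategory C) (n - m) (-n) (-m) (by lia)).symm.app _) ≪≫
      ((singleFunctors C).shiftIso (-m) m 0 (by lia)).app B
  have left (B : C) (m : ℤ) : TStructure.t.bounded ≤ fun E => Function.Surjective
      (F.mapDerivedCategory.map : (E ⟶ (singleFunctor C m).obj B) → _) := by
    have : ObjectProperty.IsClosedUnderIsomorphisms (fun E => Function.Surjective
      (F.mapDerivedCategory.map : (E ⟶ (singleFunctor C m).obj B) → _)) :=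
      ⟨fun e h => map_surjective_of_iso e (Iso.refl _) h⟩
    refine bounded_le _ (fun A n => single A B n m) fun T hT _ hT₃ h₁ h₃ => ?_
    exact map_surjective_obj₂_left hT h₁ h₃
      (inj _ _ (TStructure.t.bounded.le_shift _ _ hT₃) (bdd B m))
  have : ObjectProperty.IsClosedUnderIsomorphisms (fun E' => Function.Surjective
    (F.mapDerivedCategory.map : (E ⟶ E') → _)) :=
    ⟨fun e h => map_surjective_of_iso (Iso.refl _) e h⟩
  refine bounded_le (fun E' => Function.Surjective (F.mapDerivedCategory.map : (E ⟶ E') → _))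
    (fun B m => left B m _ hE) (fun T hT hT₁ _ h₁ h₃ => ?_) _ hE'
  exact map_surjective_obj₂_right hT h₁ h₃ (inj _ _ hE (TStructure.t.bounded.le_shift _ _ hT₁))

end Derived

/-! ### Fullness of the embedding of `D^b(C)` in the derived category of ind-objects. -/

section BoundedToInd

open DerivedCategory

variable (C : Type u) [Category.{v} C] [Abelian C] [HasDerivedCategory.{max u v} C]
  [HasDerivedCategory.{w} (IndCat C)]

omit [HasDerivedCategory.{max u v} C] [HasDerivedCategory.{w} (IndCat C)] in
lemma exists_epi_toInd_comp {c : C} {Z : IndCat C} (p : Z ⟶ (toInd C).obj c) [Epi p] :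
    ∃ (d : C) (f : d ⟶ c) (a : (toInd C).obj d ⟶ Z), Epi f ∧ a ≫ p = (toInd C).map f := by
  obtain ⟨d, f, a, hf, ha⟩ := exists_epi_yoneda_comp p
  have : Epi (AsSmall.equiv.inverse.map f) := inferInstance
  exact ⟨AsSmall.down.obj d, AsSmall.down.map f, a, this, ha⟩

lemma boundedToInd_full [(boundedToInd C).Faithful] : (boundedToInd C).Full where
  map_surjective {E E'} φ := by
    obtain ⟨f, hf⟩ := mapDerivedCategory_surjective (toInd C)
        (fun c Z p _ => exists_epi_toInd_comp C p) (fun E E' hE hE' f g hfg => by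
          let f' : (⟨E, hE⟩ : Bounded C) ⟶ ⟨E', hE'⟩ := ObjectProperty.homMk f
          let g' : (⟨E, hE⟩ : Bounded C) ⟶ ⟨E', hE'⟩ := ObjectProperty.homMk g
          have : (boundedToInd C).map f' = (boundedToInd C).map g' := ObjectProperty.hom_ext _ hfg
          exact congrArg (·.hom) ((boundedToInd C).map_injective this)) _ _ E.property E'.property φ.hom
    exact ⟨ObjectProperty.homMk f, ObjectProperty.hom_ext _ hf⟩

end BoundedToInd

end

/-! ### Computing `RHom(X, -)` on K-injective resolutions. -/

section

open CochainComplex HomComplex DerivedCategory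

lemma isIso_Q_map_shift {𝓖 : Type u} [Category.{v} 𝓖] [Abelian 𝓖] [HasDerivedCategory.{w} 𝓖]
    {K L : CochainComplex 𝓖 ℤ} (f : K ⟶ L) [IsIso (Q.map f)] (n : ℤ) : IsIso (Q.map (f⟦n⟧')) := by
  have : IsIso ((Q ⋙ CategoryTheory.shiftFunctor _ n).map f) := by
    dsimp only [Functor.comp_map]
    infer_instance
  exact (NatIso.isIso_map_iff (Q.commShiftIso n) f).2 this

lemma isIso_totalRightDerivedUnit_app {𝓖 : Type u} [Category.{v} 𝓖] [Abelian 𝓖]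
    [HasDerivedCategory.{w''} 𝓖] [EnoughInjectives 𝓖] {𝓓 : Type w} [Category.{w'} 𝓓]
    (F : HomotopyCategory.Plus 𝓖 ⥤ 𝓓) (M : CochainComplex.Plus 𝓖)
    [∀ n, Injective (M.obj.X n)] :
    IsIso ((F.totalRightDerivedUnit Plus.Qh (HomotopyCategory.Plus.quasiIso 𝓖)).app
      ((HomotopyCategory.Plus.quotient 𝓖).obj M)) :=
  inferInstance

/-- A total right derived functor is computed by bounded below complexes of injectives. -/
def totalRightDerivedObjIso {𝓖 : Type u} [Category.{v} 𝓖] [Abelian 𝓖]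
    [HasDerivedCategory.{w''} 𝓖] [EnoughInjectives 𝓖] {𝓓 : Type w} [Category.{w'} 𝓓]
    (F : HomotopyCategory.Plus 𝓖 ⥤ 𝓓) (M : CochainComplex.Plus 𝓖)
    [∀ n, Injective (M.obj.X n)] :
    F.obj ((HomotopyCategory.Plus.quotient 𝓖).obj M) ≅
      (F.totalRightDerived Plus.Qh (HomotopyCategory.Plus.quasiIso 𝓖)).obj
        (Plus.Qh.obj ((HomotopyCategory.Plus.quotient 𝓖).obj M)) :=
  have := isIso_totalRightDerivedUnit_app F M
  asIso ((F.totalRightDerivedUnit Plus.Qh (HomotopyCategory.Plus.quasiIso 𝓖)).app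
    ((HomotopyCategory.Plus.quotient 𝓖).obj M))

lemma totalRightDerivedObjIso_naturality {𝓖 : Type u} [Category.{v} 𝓖] [Abelian 𝓖]
    [HasDerivedCategory.{w''} 𝓖] [EnoughInjectives 𝓖] {𝓓 : Type w} [Category.{w'} 𝓓]
    (F : HomotopyCategory.Plus 𝓖 ⥤ 𝓓) {M M' : CochainComplex.Plus 𝓖}
    [∀ n, Injective (M.obj.X n)] [∀ n, Injective (M'.obj.X n)] (b : M ⟶ M') :
    F.map ((HomotopyCategory.Plus.quotient 𝓖).map b) ≫ (totalRightDerivedObjIso F M').hom =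
      (totalRightDerivedObjIso F M).hom ≫
        (F.totalRightDerived Plus.Qh (HomotopyCategory.Plus.quasiIso 𝓖)).map
          (Plus.Qh.map ((HomotopyCategory.Plus.quotient 𝓖).map b)) :=
  (F.totalRightDerivedUnit Plus.Qh (HomotopyCategory.Plus.quasiIso 𝓖)).naturality
    ((HomotopyCategory.Plus.quotient 𝓖).map b)

section

variable {𝓖 : Type u} [Category.{v} 𝓖] [Abelian 𝓖]
  (X : CochainComplex 𝓖 ℤ) {A : Type w} [Ring A] (ρ : A →+* End X)
  [HasDerivedCategory.{w'} (ModuleCat.{v} Aᵐᵒᵖ)]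

/-- If `Hom(X, -)` induces a surjective map on morphisms `K ⟶ L⟦m⟧` in the derived categories and
`q : Hom(X, L) ⟶ J` is a quasi-isomorphism, then `Hom(K, L) ⟶ Hom(Hom(X, K), J)` is surjective on
cohomology in degree `m`. -/
lemma exists_eq_add_δ_of_surjective {K L : CochainComplex 𝓖 ℤ}
    {J : CochainComplex (ModuleCat.{v} Aᵐᵒᵖ) ℤ} [J.IsKInjective]
    (q : homComplexObj X ρ L ⟶ J) [IsIso (Q.map q)]
    {n m r : ℤ} (h : n + 1 = m) (h' : m + 1 = r)
    (surj : ∀ φ : Q.obj (homComplexObj X ρ K) ⟶ Q.obj (homComplexObj X ρ (L⟦m⟧)),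
      ∃ a : K ⟶ L⟦m⟧, Q.map (homComplexMap X ρ a) = φ)
    (y : Cochain (homComplexObj X ρ K) J m) (hy : δ m r y = 0) :
    ∃ f : Cochain K L m, δ m r f = 0 ∧
      ∃ z, y = (postcompCochain X ρ f).comp (Cochain.ofHom q) (add_zero m) + δ n m z := by
  let c := Cocycle.mk y r h' hy
  have : IsIso (Q.map (q⟦m⟧')) := isIso_Q_map_shift q m
  obtain ⟨a, ha⟩ := surj (Q.map (Cocycle.equivHomShift.symm c) ≫ inv (Q.map (q⟦m⟧')) ≫
    inv (Q.map (homComplexShift X ρ L m)))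
  let f := Cocycle.equivHomShift a
  obtain ⟨z, hz⟩ := exists_δ_eq (c - (postcompCocycle X ρ f).postcomp q) n h (by
    rw [map_sub, Cocycle.equivHomShift_symm_postcomp, equivHomShift_symm_postcompCocycle,
      AddEquiv.symm_apply_apply, Functor.map_sub, Functor.map_comp, Functor.map_comp, ha]
    simp)
  refine ⟨f.1, Cocycle.δ_eq_zero _ _, z, ?_⟩
  rw [hz]
  exact (add_sub_cancel _ _).symm

variable [HasDerivedCategory.{w''} 𝓖]

/-- If `Hom(X, -)` induces an injective map on morphisms `K ⟶ L⟦m⟧` in the derived categories and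
`q : Hom(X, L) ⟶ J` is a quasi-isomorphism, then `Hom(K, L) ⟶ Hom(Hom(X, K), J)` is injective on
cohomology in degree `m`. -/
lemma exists_δ_eq_of_injective {K L : CochainComplex 𝓖 ℤ} [L.IsKInjective]
    {J : CochainComplex (ModuleCat.{v} Aᵐᵒᵖ) ℤ} (q : homComplexObj X ρ L ⟶ J) [IsIso (Q.map q)]
    {n m r : ℤ} (h : n + 1 = m) (h' : m + 1 = r)
    (inj : ∀ a : K ⟶ L⟦m⟧, Q.map (homComplexMap X ρ a) = 0 → Q.map a = 0)
    (f : Cochain K L m) (hf : δ m r f = 0)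
    (hz : ∃ z, δ n m z = (postcompCochain X ρ f).comp (Cochain.ofHom q) (add_zero m)) :
    ∃ f', δ n m f' = f := by
  let c := Cocycle.mk f r h' hf
  refine exists_δ_eq c n h (inj _ ?_)
  have hc := Q_map_equivHomShift_symm_eq_zero ((postcompCocycle X ρ c).postcomp q) n h hz
  rw [Cocycle.equivHomShift_symm_postcomp, equivHomShift_symm_postcompCocycle, Functor.map_comp,
    Functor.map_comp] at hc
  have : IsIso (Q.map (q⟦m⟧')) := isIso_Q_map_shift q m
  rw [← cancel_mono (Q.map (homComplexShift X ρ L m)), ← cancel_mono (Q.map (q⟦m⟧')), zero_comp,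
    zero_comp]
  exact hc

/-- Although `Hom(X, -)` need not preserve quasi-isomorphisms, it preserves homotopies, and into a
K-injective complex equality in the derived category is homotopy. -/
lemma Q_map_homComplexMap_eq {K L : CochainComplex 𝓖 ℤ} [L.IsKInjective] {a b : K ⟶ L}
    (h : Q.map a = Q.map b) : Q.map (homComplexMap X ρ a) = Q.map (homComplexMap X ρ b) := by
  have := quotient_map_eq_zero_of_Q_map_eq_zero (a - b) (by rw [Functor.map_sub, h, sub_self])
  rw [Functor.map_sub, sub_eq_zero] at this
  exact congrArg (homotopyHomFunctor X ρ).map this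

lemma isIso_Q_map_homComplexMap {K L : CochainComplex 𝓖 ℤ} [K.IsKInjective] [L.IsKInjective]
    (a : K ⟶ L) [IsIso (Q.map a)] : IsIso (Q.map (homComplexMap X ρ a)) := by
  obtain ⟨b, hb⟩ := exists_Q_map_eq (inv (Q.map a))
  refine ⟨Q.map (homComplexMap X ρ b), ?_, ?_⟩
  · rw [← Functor.map_comp, ← homComplexMap_comp, Q_map_homComplexMap_eq X ρ (b := 𝟙 K),
      homComplexMap_id, CategoryTheory.Functor.map_id]
    rw [Functor.map_comp, hb, IsIso.hom_inv_id, CategoryTheory.Functor.map_id]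
  · rw [← Functor.map_comp, ← homComplexMap_comp, Q_map_homComplexMap_eq X ρ (b := 𝟙 L),
      homComplexMap_id, CategoryTheory.Functor.map_id]
    rw [Functor.map_comp, hb, IsIso.inv_hom_id, CategoryTheory.Functor.map_id]

lemma Q_map_eq_of_δ_eq {K L : CochainComplex 𝓖 ℤ} {f g : K ⟶ L} (z : Cochain K L (-1))
    (h : Cochain.ofHom f - Cochain.ofHom g = δ (-1) 0 z) : Q.map f = Q.map g :=
  DerivedCategory.Q_map_eq_of_homotopy _
    ((Cochain.equivHomotopy f g).symm ⟨z, sub_eq_iff_eq_add.1 h⟩)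

variable [EnoughInjectives 𝓖]

/-- Termwise injectivity is what the derived functor needs, K-injectivity is what lifting of
morphisms needs; the same complex provides both. -/
lemma exists_injective_resolution (E : DerivedCategory.Plus 𝓖) :
    ∃ (M : CochainComplex.Plus 𝓖) (e : Plus.Q.obj M ≅ E) (e' : Q.obj M.obj ≅ E.obj),
      e'.hom = e.hom.hom ∧ (∀ n, Injective (M.obj.X n)) ∧ M.obj.IsKInjective := by
  obtain ⟨n, hn⟩ := E.property
  have : E.IsGE n := (DerivedCategory.Plus.isGE_ι_obj_iff E n).1 hn
  obtain ⟨L, _, ⟨e⟩⟩ := DerivedCategory.Plus.exists_injective_nonempty_iso E n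
  let M := (InjectiveObject.ι 𝓖).mapCochainComplexPlus.obj L
  have hM (i : ℤ) : Injective (M.obj.X i) := (L.obj.X i).property
  obtain ⟨d, hd⟩ := M.property
  exact ⟨M, e, Plus.ι.mapIso e, rfl, hM, isKInjective_of_injective _ d⟩

/-- On bounded below complexes of injectives, `RHom(X, -)` is given by `Hom(X, -)`. -/
def rHomFunctorObjIso (M : CochainComplex.Plus 𝓖) [∀ n, Injective (M.obj.X n)] :
    Q.obj (homComplexObj X ρ M.obj) ≅ (rHomFunctor X ρ).obj (Plus.Q.obj M) :=
  totalRightDerivedObjIso (HomotopyCategory.Plus.ι 𝓖 ⋙ homotopyHomFunctor X ρ) M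

lemma rHomFunctorObjIso_naturality {M M' : CochainComplex.Plus 𝓖} [∀ n, Injective (M.obj.X n)]
    [∀ n, Injective (M'.obj.X n)] (b : M ⟶ M') :
    Q.map (homComplexMap X ρ b.hom) ≫ (rHomFunctorObjIso X ρ M').hom =
      (rHomFunctorObjIso X ρ M).hom ≫ (rHomFunctor X ρ).map (Plus.Q.map b) :=
  totalRightDerivedObjIso_naturality (HomotopyCategory.Plus.ι 𝓖 ⋙ homotopyHomFunctor X ρ) b

/-- On K-injective resolutions, the functor `RHom(X, -)` is computed by `Hom(X, -)`. -/
lemma exists_rHomFunctor_iso : ∃ Θ : ∀ (E : DerivedCategory.Plus 𝓖)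
    (I : KInjectiveResolution E.obj),
      Q.obj (homComplexObj X ρ I.complex) ≅ (rHomFunctor X ρ).obj E,
    ∀ (E E' : DerivedCategory.Plus 𝓖) (I : KInjectiveResolution E.obj)
      (I' : KInjectiveResolution E'.obj) (f : E ⟶ E') (a : I.complex ⟶ I'.complex),
      Q.map a ≫ I'.iso.hom = I.iso.hom ≫ f.hom →
        Q.map (homComplexMap X ρ a) ≫ (Θ E' I').hom =
          (Θ E I).hom ≫ (rHomFunctor X ρ).map f := by
  choose M e e' he hM hM' using exists_injective_resolution (𝓖 := 𝓖)
  have hu (E : DerivedCategory.Plus 𝓖) (I : KInjectiveResolution E.obj) :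
      ∃ u : I.complex ⟶ (M E).obj, Q.map u = I.iso.hom ≫ (e' E).inv := exists_Q_map_eq _
  choose u hu using hu
  have hu' (E : DerivedCategory.Plus 𝓖) (I : KInjectiveResolution E.obj) :
      IsIso (Q.map (homComplexMap X ρ (u E I))) := by
    have : IsIso (Q.map (u E I)) := by
      rw [hu]
      infer_instance
    exact isIso_Q_map_homComplexMap X ρ _
  -- An arbitrary K-injective resolution is compared with the chosen bounded below one by `u`, which
  -- becomes invertible up to homotopy and so survives `Hom(X, -)`.
  refine ⟨fun E I => asIso (Q.map (homComplexMap X ρ (u E I))) ≪≫ rHomFunctorObjIso X ρ (M E) ≪≫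
    (rHomFunctor X ρ).mapIso (e E), fun E E' I I' f a hf => ?_⟩
  obtain ⟨b, hb⟩ := exists_Q_map_eq ((e' E).hom ≫ f.hom ≫ (e' E').inv)
  have hb' : Plus.Q.map (ObjectProperty.homMk b : M E ⟶ M E') ≫ (e E').hom = (e E).hom ≫ f := by
    ext
    change Q.map b ≫ (e E').hom.hom = (e E).hom.hom ≫ f.hom
    rw [hb, ← he, ← he, Category.assoc, Category.assoc, Iso.inv_hom_id, Category.comp_id]
    rfl
  have h₁ := Q_map_homComplexMap_eq X ρ (a := a ≫ u E' I') (b := u E I ≫ b) (by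
    rw [Functor.map_comp, Functor.map_comp, hu, hu, hb, reassoc_of% hf, Category.assoc,
      Iso.inv_hom_id_assoc])
  rw [homComplexMap_comp, homComplexMap_comp, Functor.map_comp, Functor.map_comp] at h₁
  have h₂ := rHomFunctorObjIso_naturality X ρ (ObjectProperty.homMk b : M E ⟶ M E')
  have h₃ := congrArg (rHomFunctor X ρ).map hb'
  rw [Functor.map_comp, Functor.map_comp] at h₃
  change Q.map (homComplexMap X ρ a) ≫ Q.map (homComplexMap X ρ (u E' I')) ≫
    (rHomFunctorObjIso X ρ (M E')).hom ≫ (rHomFunctor X ρ).map (e E').hom =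
      (Q.map (homComplexMap X ρ (u E I)) ≫ (rHomFunctorObjIso X ρ (M E)).hom ≫
        (rHomFunctor X ρ).map (e E).hom) ≫ (rHomFunctor X ρ).map f
  rw [reassoc_of% h₁, Category.assoc, Category.assoc, ← h₃, ← reassoc_of% h₂]
  rfl

end

/-! ### The roof of dg categories and the main theorem. -/

variable {C : Type u} [Category.{v} C] [Abelian C] [HasDerivedCategory.{max u v} C]
  [HasDerivedCategory.{w} (IndCat C)]

/-- The shift of a K-injective resolution. -/
def KInjectiveResolution.shiftBounded {E : DerivedCategory.Bounded C}
    (I : KInjectiveResolution ((boundedToInd C).obj E).obj) (m : ℤ) :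
    KInjectiveResolution ((boundedToInd C).obj (E⟦m⟧)).obj where
  complex := I.complex⟦m⟧
  iso := (Q.commShiftIso m).app _ ≪≫ (CategoryTheory.shiftFunctor _ m).mapIso I.iso ≪≫
    ((toInd C).mapDerivedCategory.commShiftIso m).symm.app E.obj ≪≫
      (toInd C).mapDerivedCategory.mapIso ((Bounded.ι.commShiftIso m).symm.app E)

variable {k : Type t} [CommRing k] [Linear k C] {T : DerivedCategory.Bounded C} (X : Model k T)
  [HasDerivedCategory.{w'} (ModuleCat.{max u v} (End T)ᵐᵒᵖ)]

lemma Model.exists_rHom_iso : ∃ Θ : ∀ (E : DerivedCategory.Bounded C)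
    (I : KInjectiveResolution ((boundedToInd C).obj E).obj),
      Q.obj (homComplexObj X.complex X.action.toRingHom I.complex) ≅ X.rHom.obj E,
    ∀ (E E' : DerivedCategory.Bounded C) (I : KInjectiveResolution ((boundedToInd C).obj E).obj)
      (I' : KInjectiveResolution ((boundedToInd C).obj E').obj) (f : E ⟶ E')
      (a : I.complex ⟶ I'.complex),
      Q.map a ≫ I'.iso.hom = I.iso.hom ≫ ((boundedToInd C).map f).hom →
        Q.map (homComplexMap X.complex X.action.toRingHom a) ≫ (Θ E' I').hom =
          (Θ E I).hom ≫ X.rHom.map f := by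
  obtain ⟨Θ, hΘ⟩ := exists_rHomFunctor_iso X.complex X.action.toRingHom
  exact ⟨fun E I => Θ ((boundedToInd C).obj E) I, fun E E' I I' f a h =>
    hΘ _ _ I I' ((boundedToInd C).map f) a h⟩

open scoped ModuleCat.Algebra in
theorem Model.isDGEquivalence_of_full_of_faithful [X.rHom.Full] [X.rHom.Faithful] :
    Model.IsDGEquivalence.{t, s} X := by
  have : (boundedToInd C).Faithful := Functor.Faithful.of_comp_eq (H := X.rHom) rfl
  have : (boundedToInd C).Full := boundedToInd_full C
  intro ι E I J
  obtain ⟨Θ, hΘ⟩ := X.exists_rHom_iso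
  have hq (i : ι) : ∃ q : homComplexObj X.complex X.action.toRingHom (I i).complex ⟶
      (J i).complex, Q.map q = (Θ _ (I i)).hom ≫ (J i).iso.inv :=
    exists_Q_map_eq _
  choose q hq using hq
  have (i : ι) : IsIso (Q.map (q i)) := by
    rw [hq]
    infer_instance
  let Φ := homComplexDG k X.complex X.action fun i => (I i).complex
  refine ⟨homotopyPullback Φ q, homotopyPullbackFst Φ q, homotopyPullbackSnd Φ q,
    homotopyPullbackFst_isQuasiIso Φ q (fun h h' g hg hz => exists_precomp_δ_eq _ h h' g hg hz)
      (fun h h' y hy => exists_eq_precomp_add_δ _ h h' y hy),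
    homotopyPullbackSnd_isQuasiIso Φ q ?_ ?_, ?_⟩
  · intro i j n m r h h' f hf hz
    refine exists_δ_eq_of_injective X.complex X.action.toRingHom (q j) h h' (fun a ha => ?_)
      f hf hz
    -- Injectivity is where fullness of `boundedToInd` enters: `a` must come from `D^b(C)` before
    -- faithfulness of `Ψ` applies. Treating `(I j).complex⟦m⟧` as a resolution of `(E j)⟦m⟧` avoids
    -- any comparison of `Ψ` with shifts.
    obtain ⟨f, hf⟩ := (boundedToInd C).map_surjective (ObjectProperty.homMk
      ((I i).iso.inv ≫ Q.map a ≫ ((I j).shiftBounded m).iso.hom) :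
        (boundedToInd C).obj (E i) ⟶ (boundedToInd C).obj ((E j)⟦m⟧))
    have hf' : Q.map a ≫ ((I j).shiftBounded m).iso.hom =
        (I i).iso.hom ≫ ((boundedToInd C).map f).hom := by
      rw [← Iso.inv_comp_eq]
      exact (congrArg (·.hom) hf).symm
    have h₁ := hΘ _ _ (I i) ((I j).shiftBounded m) f a hf'
    have h₂ : X.rHom.map f = 0 := by
      rw [← cancel_epi (Θ _ (I i)).hom, ← h₁, comp_zero]
      exact (congrArg (· ≫ _) ha).trans zero_comp
    have h₀ : ((boundedToInd C).map (0 : E i ⟶ (E j)⟦m⟧)).hom = 0 :=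
      (toInd C).mapDerivedCategory.map_zero _ _
    -- The zero morphism is represented by the zero chain map, so naturality of `Θ` gives this
    -- without additivity of `Ψ`.
    have h₃ : X.rHom.map (0 : E i ⟶ (E j)⟦m⟧) = 0 := by
      have := hΘ _ _ (I i) ((I j).shiftBounded m) 0 0 (by
        rw [h₀, comp_zero, Functor.map_zero, zero_comp])
      rw [homComplexMap_zero, Functor.map_zero, zero_comp] at this
      rw [← cancel_epi (Θ _ (I i)).hom, ← this, comp_zero]
    have h₄ : f = 0 := X.rHom.map_injective (h₂.trans h₃.symm)
    rw [h₄, h₀, comp_zero] at hf'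
    exact ((cancel_mono ((I j).shiftBounded m).iso.hom).1 (hf'.trans zero_comp.symm))
  · intro i j n m r h h' y hy
    refine exists_eq_add_δ_of_surjective X.complex X.action.toRingHom (q j) h h' (fun φ => ?_)
      y hy
    obtain ⟨f, hf⟩ := X.rHom.map_surjective ((Θ _ (I i)).inv ≫ φ ≫
      (Θ _ ((I j).shiftBounded m)).hom : X.rHom.obj (E i) ⟶ X.rHom.obj ((E j)⟦m⟧))
    obtain ⟨a, ha⟩ := exists_Q_map_eq ((I i).iso.hom ≫ ((boundedToInd C).map f).hom ≫
      ((I j).shiftBounded m).iso.inv)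
    refine ⟨a, ?_⟩
    have h₁ := hΘ _ _ (I i) ((I j).shiftBounded m) f a (by
      rw [ha, Category.assoc, Category.assoc, Iso.inv_hom_id, Category.comp_id])
    rw [hf, Iso.hom_inv_id_assoc] at h₁
    exact (Iso.cancel_iso_hom_right _ _ (Θ _ ((I j).shiftBounded m))).1 h₁
  · rintro i j ⟨f, g, z⟩ φ a b hx ha hb hφ
    obtain ⟨-, -, hz⟩ := (pullbackD_eq_iff Φ q _ _ _).1 hx
    obtain rfl : f = Cochain.ofHom a := ha
    obtain rfl : g = Cochain.ofHom b := hb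
    have h₁ := hΘ _ _ (I i) (I j) φ a hφ
    -- Closedness of the triple says precisely that `z` is a homotopy making this square commute.
    have h₂ : Q.map (homComplexMap X.complex X.action.toRingHom a ≫ q j) = Q.map (q i ≫ b) := by
      refine Q_map_eq_of_δ_eq z ?_
      rw [Cochain.ofHom_comp, Cochain.ofHom_comp, ← postcompCochain_ofHom]
      exact sub_eq_zero.1 hz
    rw [Functor.map_comp, Functor.map_comp, hq, hq, reassoc_of% h₁, Category.assoc] at h₂
    have h₃ := (Iso.cancel_iso_hom_left _ _ _).1 h₂
    rw [Iso.comp_inv_eq, Category.assoc] at h₃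
    rw [h₃, Iso.hom_inv_id_assoc]

end

end TiltingDG

end

theorem mainTheorem11 {k : Type t} [CommRing k]
    {C : Type u} [Category.{v} C] [Abelian C] [Linear k C]
    [HasDerivedCategory.{max u v} C] [HasDerivedCategory.{w} (TiltingDG.IndCat C)]
    (T : DerivedCategory.Bounded C)
    [HasDerivedCategory.{w'} (ModuleCat.{max u v} (End T)ᵐᵒᵖ)]
    (X : TiltingDG.Model k T)
    (𝓜 : ObjectProperty (ModuleCat.{max u v} (End T)ᵐᵒᵖ)) (hT : X.IsTilting 𝓜) :
    TiltingDG.Model.IsDGEquivalence.{t, s} X ∧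
      ∀ E : DerivedCategory.Bounded C, X.REndQuasiIsomorphic E := by
  have := hT.full
  have := hT.faithful
  refine ⟨X.isDGEquivalence_of_full_of_faithful, fun E I J => ?_⟩
  obtain ⟨S, F, G, hF, hG, -⟩ := X.isDGEquivalence_of_full_of_faithful PUnit (fun _ => E)
    (fun _ => I) (fun _ => J)
  exact ⟨S, F, G, hF, hG⟩
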